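/- Let $\alpha>0$ and let $(X_i,Y_i)_{i\ge1}$ be i.i.d. random vectors distributed as $(X,Y)$, with $X$ real-valued and $Y\ge 0$; write $F,G$ for the laws of $X,Y$, $\overline F(x)=P[X>x]$, $\overline G(x)=P[Y>x]$. Suppose: 1. $(X,Y)$ is bivariate Sarmanov: $P(X\in dx,Y\in dy)=(1+\theta\phi_1(x)\phi_2(y))F(dx)G(dy)$, where $\theta\in\mathbb R$ and $\phi_1,\phi_2$ are measurable real functions with $E[\phi_1(X)]=E[\phi_2(Y)]=0$ and $1+\theta\phi_1(x)\phi_2(y)\ge0$ for all $x,y$ in the supports of $X,Y$ respectively. 2. $X\in RV_{-\alpha}$, i.e. $\overline F(xy)/\overline F(x)\to y^{-\alpha}$ as $x\to\infty$ for each $y>0$. 3. $E[Y^\alpha]<\infty$, $\overline G(x)=o(\overline F(x))$, and $\lim_{x\to\infty}\phi_1(x)=d_1$ exists in $\mathbb R$. 4. At least one of the conditions (DZ2), (DZ3), (DZ4) below holds. Put $L(x)=x^\alpha\overline F(x)$. A random variable $U$ is long tailed if $P[U>x+y]/P[U>x]\to1$ as $x\to\infty$ for each $y\in\mathbb R$.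 Say that $L$ is of type (iii)/(iv) with $U$ if, for $x>0$, either $L(x)=c(x)P[U>\log x]$ or $L(x)=c(x)P[U>\log x]/P[V>\log x]$, where $U$ and $V$ are long tailed and $c(x)\to c\in(0,\infty)$ as $x\to\infty$. A nonnegative, eventually positive function $f$ belongs to $\mathcal S_d$ if $\lim_{x\to\infty}\int_0^x\frac{f(x-y)}{f(x)}f(y)\,dy=2\int_0^\infty f(u)\,du<\infty$; and $U\in\mathcal S^*$ if $x\mapsto P[U>x]$ belongs to $\mathcal S_d$. * (DZ2) $L$ is of type (iii)/(iv) with some $U$, and $x\mapsto L(e^x)$ belongs to $\mathcal S_d$. * (DZ3) $L$ is of type (iii)/(iv) with some $U\in\mathcal S^*$ such that $P[Y>x]=o(x^{-\alpha}P[U>\log x])$. * (DZ4) $m(x)=\int_{[0,x]}v^\alpha F(dv)\to\infty$ as $x\to\infty$, $P[Y>x]=o(P[X>x]/m(x))$, and $\limsup_{x\to\infty}\sup_{\sqrt x\le y\le x}L(y)/L(x)<\infty$. For $n\ge1$ let $\Psi(x,n)=P\left[\max_{1\le k\le n}\sum_{i=1}^kX_i\prod_{j=1}^iY_j>x\right]$,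 and put $C=E[Y^\alpha]+\theta d_1E[\phi_2(Y)Y^\alpha]$. Then $E|\phi_2(Y)Y^\alpha|<\infty$ whenever $\theta d_1\ne0$ (the second term of $C$ being read as $0$ when $\theta d_1=0$), and as $x\to\infty$ $$\frac{\Psi(x,n)}{\overline F(x)}\longrightarrow \frac{1-E[Y^\alpha]^n}{1-E[Y^\alpha]}\,C,$$ where the fraction on the right is read as $n$ when $E[Y^\alpha]=1$. In particular, if $C\neq0$, then $$\Psi(x,n)\sim\frac{1-E[Y^\alpha]^n}{1-E[Y^\alpha]}\left(E[Y^\alpha]+\theta d_1E[\phi_2(Y)Y^\alpha]\right)\overline F(x).$$ -/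

import Mathlib

open MeasureTheory ProbabilityTheory Filter Topology Asymptotics
open scoped ENNReal

namespace Ruin

noncomputable section

/-- Tail (survival) function `x ↦ μ (x, ∞)` of a law `μ` on the real line. -/
def tail (μ : Measure ℝ) (x : ℝ) : ℝ := μ.real (Set.Ioi x)

/-- The law `F` is regularly varying with index `-α`, `α > 0`:
`tail F (x y) ~ y ^ (-α) tail F x` as `x → ∞`, for every `y > 0`.
(The limits force `tail F` to be everywhere positive.) -/
def IsRegVarying (α : ℝ) (F : Measure ℝ) : Prop :=
  0 < α ∧ ∀ y : ℝ, 0 < y →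
    Tendsto (fun x : ℝ => tail F (x * y) / tail F x) atTop (𝓝 (y ^ (-α)))

/-- The law `μ` is long tailed: `tail μ (x + y) ~ tail μ x` as `x → ∞`, for every real `y`.
(The limits force `tail μ` to be everywhere positive.) -/
def IsLongTailed (μ : Measure ℝ) : Prop :=
  ∀ y : ℝ, Tendsto (fun x : ℝ => tail μ (x + y) / tail μ x) atTop (𝓝 1)

/-- The class `S_d` of subexponential densities: `f ≥ 0` and
`∫₀ˣ f (x - y) / f x * f y dy → 2 ∫₀^∞ f < ∞` as `x → ∞`. -/
structure IsSubexpDensity (f : ℝ → ℝ) : Prop where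
  nonneg : ∀ x, 0 ≤ f x
  eventually_pos : ∀ᶠ x in atTop, 0 < f x
  integrableOn : IntegrableOn f (Set.Ioi 0)
  tendsto_conv : Tendsto (fun x : ℝ => ∫ y in (0 : ℝ)..x, f (x - y) / f x * f y) atTop
    (𝓝 (2 * ∫ u in Set.Ioi (0 : ℝ), f u))

/-- The class `S*`: laws whose tail function is a subexponential density. -/
def IsSStar (μ : Measure ℝ) : Prop := IsSubexpDensity (tail μ)

/-- The slowly varying part `L x = x ^ α * tail F x` of the tail of `F`. -/
def slowPart (α : ℝ) (F : Measure ℝ) (x : ℝ) : ℝ := x ^ α * tail F x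

/-- `L x = c x * P (U > log x)` with `U` long tailed (of law `μU`) and
`c x → c₀ ∈ (0, ∞)` as `x → ∞`. -/
def IsTypeThree (L : ℝ → ℝ) (μU : Measure ℝ) : Prop :=
  IsLongTailed μU ∧
  ∃ (c : ℝ → ℝ) (c₀ : ℝ), 0 < c₀ ∧ Tendsto c atTop (𝓝 c₀) ∧
    ∀ x : ℝ, 0 < x → L x = c x * tail μU (Real.log x)

/-- `L x = c x * P (U > log x) / P (V > log x)` with `U`, `V` long tailed
(of laws `μU`, `μV`) and `c x → c₀ ∈ (0, ∞)` as `x → ∞`. -/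
def IsTypeFour (L : ℝ → ℝ) (μU μV : Measure ℝ) : Prop :=
  IsLongTailed μU ∧ IsLongTailed μV ∧
  ∃ (c : ℝ → ℝ) (c₀ : ℝ), 0 < c₀ ∧ Tendsto c atTop (𝓝 c₀) ∧
    ∀ x : ℝ, 0 < x → L x = c x * tail μU (Real.log x) / tail μV (Real.log x)

/-- `L` has one of the two preceding representations, with `U` of law `μU`. -/
def IsTypeThreeOrFour (L : ℝ → ℝ) (μU : Measure ℝ) : Prop :=
  IsTypeThree L μU ∨ ∃ μV : Measure ℝ, IsProbabilityMeasure μV ∧ IsTypeFour L μU μV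

/-- Condition (DZ2) on the law `F` of `X`. -/
def DZ2 (α : ℝ) (F : Measure ℝ) : Prop :=
  (∃ μU : Measure ℝ, IsProbabilityMeasure μU ∧ IsTypeThreeOrFour (slowPart α F) μU) ∧
  IsSubexpDensity (fun x => slowPart α F (Real.exp x))

/-- Condition (DZ3) on the laws `F` of `X` and `G` of `Y`. -/
def DZ3 (α : ℝ) (F G : Measure ℝ) : Prop :=
  ∃ μU : Measure ℝ, IsProbabilityMeasure μU ∧ IsTypeThreeOrFour (slowPart α F) μU ∧
    IsSStar μU ∧
    tail G =o[atTop] (fun x : ℝ => x ^ (-α) * tail μU (Real.log x))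

/-- The truncated moment `m x = ∫_[0,x] v ^ α F(dv)`. -/
def truncMoment (α : ℝ) (F : Measure ℝ) (x : ℝ) : ℝ := ∫ v in Set.Icc 0 x, v ^ α ∂F

/-- Condition (DZ4) on the laws `F` of `X` and `G` of `Y`. The first clause says that
the `α`-th moment of the positive part of `X` is infinite. -/
def DZ4 (α : ℝ) (F G : Measure ℝ) : Prop :=
  Tendsto (truncMoment α F) atTop atTop ∧
  tail G =o[atTop] (fun x : ℝ => tail F x / truncMoment α F x) ∧
  limsup (fun x : ℝ => ⨆ y ∈ Set.Icc (Real.sqrt x) x,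
    ENNReal.ofReal (slowPart α F y / slowPart α F x)) atTop < ⊤

/-- `(X, Y)` follows the bivariate Sarmanov distribution with parameter `θ` and kernels
`φ₁`, `φ₂`: `Y ≥ 0`, `P (X ∈ dx, Y ∈ dy) = (1 + θ φ₁(x) φ₂(y)) F(dx) G(dy)`, the kernels
are centred, and `1 + θ φ₁(x) φ₂(y) ≥ 0` on the product of the supports of `X` and `Y`. -/
structure IsSarmanov {Ω : Type*} [MeasurableSpace Ω] (P : Measure Ω) (X Y : Ω → ℝ)
    (θ : ℝ) (φ₁ φ₂ : ℝ → ℝ) : Prop where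
  measurable_fst : Measurable φ₁
  measurable_snd : Measurable φ₂
  nonneg : ∀ᵐ ω ∂P, 0 ≤ Y ω
  integrable_fst : Integrable (fun ω => φ₁ (X ω)) P
  integrable_snd : Integrable (fun ω => φ₂ (Y ω)) P
  mean_fst : ∫ ω, φ₁ (X ω) ∂P = 0
  mean_snd : ∫ ω, φ₂ (Y ω) ∂P = 0
  density_nonneg : ∀ x ∈ (P.map X).support, ∀ y ∈ (P.map Y).support,
    0 ≤ 1 + θ * φ₁ x * φ₂ y
  law_eq : P.map (fun ω => (X ω, Y ω)) =
    ((P.map X).prod (P.map Y)).withDensity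
      (fun p => ENNReal.ofReal (1 + θ * φ₁ p.1 * φ₂ p.2))

/-- The discounted aggregate loss up to time `k`: the sum of the first `k` terms
`X_i ∏_{j ≤ i} Y_j`. The sequences are indexed from `0`. -/
def aggLoss {Ω : Type*} (X Y : ℕ → Ω → ℝ) (k : ℕ) (ω : Ω) : ℝ :=
  ∑ i ∈ Finset.range k, X i ω * ∏ j ∈ Finset.range (i + 1), Y j ω

/-- The finite time ruin probability `P (max_{1 ≤ k ≤ n} S_k > x)`. -/
def ruinProb {Ω : Type*} [MeasurableSpace Ω] (P : Measure Ω) (X Y : ℕ → Ω → ℝ)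
    (n : ℕ) (hn : 1 ≤ n) (x : ℝ) : ℝ :=
  P.real {ω | x < (Finset.Icc 1 n).sup' (Finset.nonempty_Icc.mpr hn)
    (fun k => aggLoss X Y k ω)}

/-- `(1 - a ^ n) / (1 - a)`, read as `n` when `a = 1`. -/
def geomFactor (a : ℝ) (n : ℕ) : ℝ :=
  open Classical in if a = 1 then (n : ℝ) else (1 - a ^ n) / (1 - a)

/-- The constant `E[Y^α] + θ d₁ E[φ₂(Y) Y^α]`. -/
def ruinConst {Ω : Type*} [MeasurableSpace Ω] (P : Measure Ω) (Y : Ω → ℝ)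
    (α θ d₁ : ℝ) (φ₂ : ℝ → ℝ) : ℝ :=
  (∫ ω, Y ω ^ α ∂P) + θ * d₁ * ∫ ω, φ₂ (Y ω) * Y ω ^ α ∂P

end

end Ruin

/-! Write `S_k` for the aggregate losses, `F̄` and `Ḡ` for the tails, `a = E[Y^α]`. For `x ≥ 0`
adjoining `S_0 = 0` does not change the event, and reading time backwards gives `M_{n+1} = max(0, Y
(X + M'))`, where `M'` is the maximum `M_n` of the shifted sequence and is independent of `(X, Y)`.
Suppose `P(M_n > x) / F̄(x) → c_n`. Given `Y = y`, the law of `X` has density `1 + θ φ₁ φ₂(y)` with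
respect to `F`, so its tail is asymptotic in ratio to `(1 + θ d₁ φ₂(y)) F̄`. A single big jump
(`IsRegVarying.tendsto_measureReal_lt_add`) adds `c_n`, and regular variation turns the factor `y`
into `y^α`. Integrating over `y` gives `c_{n+1} = C + a c_n` with `c_0 = 0`, a geometric sum.

The delicate point is exchanging limit and integral (`TailNegligible.tendsto_integral_div`).
Nonnegativity and centring bound the Sarmanov density, so the integrand is at most a constant times
`F̄(x/y)`. This is dominated for `y ≤ K`; for `y > K` one needs `TailNegligible`, which each of the
three conditions supplies. Under (DZ2) and (DZ3) the logarithmic scale turns the integral into a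
discretised self-convolution of a subexponential density (`tailNegligible_of_convolution`). Under
(DZ4) the range of `y` is cut at `√x`. -/

namespace Ruin

/-! ### Tails of laws and regular variation -/

section Tail

variable {μ : Measure ℝ}

theorem tail_nonneg (x : ℝ) : 0 ≤ tail μ x := measureReal_nonneg

theorem tail_antitone [IsFiniteMeasure μ] : Antitone (tail μ) :=
  fun _ _ h => measureReal_mono (Set.Ioi_subset_Ioi h)

theorem tail_le_one [IsProbabilityMeasure μ] (x : ℝ) : tail μ x ≤ 1 := measureReal_le_one

theorem tendsto_tail_atTop [IsFiniteMeasure μ] : Tendsto (tail μ) atTop (𝓝 0) := by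
  have h := tendsto_measure_iInter_atTop (μ := μ) (s := fun x : ℝ => Set.Ioi x)
    (fun _ => measurableSet_Ioi.nullMeasurableSet) (fun _ _ h => Set.Ioi_subset_Ioi h)
    ⟨0, measure_ne_top _ _⟩
  have h0 : (⋂ x : ℝ, Set.Ioi x) = ∅ := by
    ext z
    simp only [Set.mem_iInter, Set.mem_Ioi, Set.mem_empty_iff_false, iff_false, not_forall, not_lt]
    exact ⟨z, le_rfl⟩
  rw [h0, measure_empty] at h
  exact (ENNReal.tendsto_toReal ENNReal.zero_ne_top).comp h

theorem tail_pos_of_tendsto_one [IsFiniteMeasure μ] {u : ℝ → ℝ}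
    (h : Tendsto (fun x => u x / tail μ x) atTop (𝓝 1)) (x : ℝ) : 0 < tail μ x := by
  have h1 := h.eventually_ne one_ne_zero
  obtain ⟨z, hz, hxz⟩ := (h1.and (eventually_ge_atTop x)).exists
  have : tail μ z ≠ 0 := fun h0 => hz (by simp [h0])
  exact ((tail_nonneg z).lt_of_ne' this).trans_le (tail_antitone hxz)

theorem IsLongTailed.tail_pos [IsFiniteMeasure μ] (h : IsLongTailed μ) (x : ℝ) : 0 < tail μ x :=
  tail_pos_of_tendsto_one (h 0) x

theorem IsRegVarying.tail_pos [IsFiniteMeasure μ] {α : ℝ} (h : IsRegVarying α μ) (x : ℝ) :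
    0 < tail μ x := by
  have := h.2 1 one_pos
  rw [Real.one_rpow] at this
  exact tail_pos_of_tendsto_one this x

/-- Rescaling the argument changes a regularly varying tail at most by a constant factor. -/
theorem IsRegVarying.exists_tail_mul_le [IsFiniteMeasure μ] {α : ℝ} (h : IsRegVarying α μ)
    {b : ℝ} (hb : 0 < b) : ∃ A > 0, ∀ᶠ x in atTop, tail μ (x * b) ≤ A * tail μ x := by
  have hp : 0 < b ^ (-α) := Real.rpow_pos_of_pos hb _
  refine ⟨b ^ (-α) + 1, by positivity, ?_⟩
  filter_upwards [(h.2 b hb).eventually_lt_const (lt_add_one _)] with x hx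
  exact ((div_lt_iff₀ (h.tail_pos x)).1 hx).le

theorem IsRegVarying.eventually_tail_mul_le [IsFiniteMeasure μ] {α : ℝ} (h : IsRegVarying α μ)
    {ν : Measure ℝ} (hν : tail ν =o[atTop] tail μ)
    {b ε : ℝ} (hb : 0 < b) (hε : 0 < ε) : ∀ᶠ x in atTop, tail ν (x * b) ≤ ε * tail μ x := by
  obtain ⟨A, hA, hx⟩ := h.exists_tail_mul_le hb
  have h1 := hν.bound (div_pos hε hA)
  have h2 : Tendsto (fun x : ℝ => x * b) atTop atTop := tendsto_id.atTop_mul_const hb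
  filter_upwards [hx, h2.eventually h1] with x hx1 hx2
  rw [Real.norm_of_nonneg (tail_nonneg _), Real.norm_of_nonneg (tail_nonneg _)] at hx2
  refine hx2.trans ?_
  calc ε / A * tail μ (x * b) ≤ ε / A * (A * tail μ x) := by gcongr
    _ = ε * tail μ x := by field_simp

theorem slowPart_exp (α : ℝ) (t : ℝ) :
    slowPart α μ (Real.exp t) = Real.exp (α * t) * tail μ (Real.exp t) := by
  rw [slowPart, ← Real.exp_mul, mul_comm t]

theorem integrable_tail_div [IsProbabilityMeasure μ] (ν : Measure ℝ) [IsFiniteMeasure ν] (x : ℝ) :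
    Integrable (fun y => tail μ (x / y)) ν := by
  refine Integrable.of_bound (C := 1)
    ((tail_antitone.measurable.comp (measurable_const.div measurable_id)).aestronglyMeasurable) ?_
  exact Eventually.of_forall fun y => by
    rw [Real.norm_of_nonneg (tail_nonneg _)]; exact tail_le_one _

end Tail

/-- Large values of the multiplier `y` do not contribute to the tail of the product of
independent variables of laws `F` and `G`. -/
def TailNegligible (F G : Measure ℝ) : Prop :=
  ∀ ε > 0, ∃ K > 0, ∀ᶠ x in atTop, ∫ y in Set.Ioi K, tail F (x / y) ∂G ≤ ε * tail F x

/-! ### Large multipliers in logarithmic scale -/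

section Exponential

variable {F G : Measure ℝ} [IsProbabilityMeasure F] [IsProbabilityMeasure G]

/-- Cutting at powers of `e`: on each shell both tails are monotone, and beyond `e^N` the tail of
`F` is at most one. -/
theorem setIntegral_tail_div_le_sum {x : ℝ} (hx : 0 ≤ x) {k N : ℕ} (hkN : k ≤ N) :
    ∫ y in Set.Ioi (Real.exp k), tail F (x / y) ∂G ≤
      ∑ i ∈ Finset.Ico k N, tail F (x / Real.exp (i + 1)) * tail G (Real.exp i) +
        tail G (Real.exp N) := by
  have hint : Integrable (fun y => tail F (x / y)) G := integrable_tail_div G x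
  have key : ∫ y in Set.Ioi (Real.exp k), tail F (x / y) ∂G ≤
      ∑ i ∈ Finset.Ico k N, tail F (x / Real.exp (i + 1)) * tail G (Real.exp i) +
        ∫ y in Set.Ioi (Real.exp N), tail F (x / y) ∂G := by
    induction N, hkN using Nat.le_induction with
    | base => simp
    | succ N hN ih =>
      refine ih.trans ?_
      rw [Finset.sum_Ico_succ_top hN, add_assoc]
      gcongr
      have hle : Real.exp N ≤ Real.exp (N + 1) := Real.exp_le_exp.2 (by linarith)
      rw [← Set.Ioc_union_Ioi_eq_Ioi hle, setIntegral_union (Set.Ioc_disjoint_Ioi le_rfl)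
        measurableSet_Ioi hint.integrableOn hint.integrableOn, Nat.cast_succ]
      gcongr
      calc ∫ y in Set.Ioc (Real.exp N) (Real.exp (N + 1)), tail F (x / y) ∂G
          ≤ ∫ y in Set.Ioc (Real.exp N) (Real.exp (N + 1)), tail F (x / Real.exp (N + 1)) ∂G :=
            setIntegral_mono_on hint.integrableOn (integrable_const _).integrableOn
              measurableSet_Ioc fun y hy => tail_antitone
                (div_le_div_of_nonneg_left hx ((Real.exp_pos _).trans hy.1) hy.2)
        _ = tail F (x / Real.exp (N + 1)) *
            G.real (Set.Ioc (Real.exp N) (Real.exp (N + 1))) := by simp [mul_comm]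
        _ ≤ _ := mul_le_mul_of_nonneg_left (measureReal_mono Set.Ioc_subset_Ioi_self)
            (tail_nonneg _)
  refine key.trans ?_
  gcongr
  calc ∫ y in Set.Ioi (Real.exp N), tail F (x / y) ∂G
      ≤ ∫ y in Set.Ioi (Real.exp N), (1 : ℝ) ∂G :=
        setIntegral_mono hint.integrableOn (integrable_const _).integrableOn
          fun y => tail_le_one _
    _ = _ := by simp [tail]

/-- A locally comparable function has its products over unit steps controlled by the
corresponding convolution integral. -/
theorem sum_mul_le_intervalIntegral {g : ℝ → ℝ} {A T t : ℝ} (hA : 0 ≤ A) (hg : ∀ s, 0 ≤ g s)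
    (hcomp : ∀ s t, T ≤ s → T ≤ t → |s - t| ≤ 1 → g s ≤ A * g t)
    (ht : 0 ≤ t) (hint : IntervalIntegrable (fun z => g (t - z) * g z) volume 0 t)
    {k N : ℕ} (hkN : k ≤ N) (hk : T ≤ k) (hN : T ≤ t - N) (hNt : (N : ℝ) ≤ t) :
    ∑ i ∈ Finset.Ico k N, g (t - i - 1) * g i ≤ A ^ 2 * ∫ z in (0 : ℝ)..t, g (t - z) * g z := by
  have hsub : ∀ a b : ℝ, 0 ≤ a → a ≤ b → b ≤ t →
      IntervalIntegrable (fun z => g (t - z) * g z) volume a b := fun a b h0 hab hb =>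
    hint.mono_set (by
      rw [Set.uIcc_of_le hab, Set.uIcc_of_le ht]; exact Set.Icc_subset_Icc h0 hb)
  -- For `z` in `[i, i + 1]` both arguments move by at most one, each costing a factor `A`; they
  -- stay above `T` because `i + 1 ≤ N` and `T ≤ t - N`.
  have hstep : ∀ i ∈ Finset.Ico k N, g (t - i - 1) * g i ≤
      A ^ 2 * ∫ z in (i : ℝ)..((i + 1 : ℕ) : ℝ), g (t - z) * g z := by
    intro i hi
    rw [Finset.mem_Ico] at hi
    have h1 : (k : ℝ) ≤ i := by exact_mod_cast hi.1
    have h2 : (i : ℝ) + 1 ≤ N := by exact_mod_cast hi.2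
    have h0 : (0 : ℝ) ≤ i := Nat.cast_nonneg i
    rw [← intervalIntegral.integral_const_mul]
    have h3 : (∫ z in (i : ℝ)..((i + 1 : ℕ) : ℝ), g (t - i - 1) * g i) = g (t - i - 1) * g i := by
      simp
    rw [← h3]
    refine intervalIntegral.integral_mono_on (by push_cast; linarith) (by simp)
      ((hsub _ _ h0 (by push_cast; linarith) (by push_cast; linarith)).const_mul _) ?_
    intro z hz
    push_cast at hz
    have h4 : g (t - i - 1) ≤ A * g (t - z) :=
      hcomp _ _ (by linarith) (by linarith [hz.2])
        (abs_le.2 ⟨by linarith [hz.1], by linarith [hz.2]⟩)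
    have h5 : g i ≤ A * g z :=
      hcomp _ _ (by linarith) (by linarith [hz.1])
        (abs_le.2 ⟨by linarith [hz.2], by linarith [hz.1]⟩)
    calc g (t - i - 1) * g i ≤ (A * g (t - z)) * (A * g z) :=
          mul_le_mul h4 h5 (hg _) (mul_nonneg hA (hg _))
      _ = _ := by ring
  refine (Finset.sum_le_sum hstep).trans ?_
  rw [← Finset.mul_sum, intervalIntegral.sum_integral_adjacent_intervals_Ico
    (f := fun z => g (t - z) * g z) (a := fun i : ℕ => (i : ℝ)) hkN]
  · gcongr
    have h0 : (0 : ℝ) ≤ k := Nat.cast_nonneg k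
    have hkN' : (k : ℝ) ≤ N := by exact_mod_cast hkN
    refine intervalIntegral.integral_mono_interval h0 hkN' hNt ?_ hint
    exact Eventually.of_forall fun z => mul_nonneg (hg _) (hg _)
  · intro i hi
    have h2 : (i : ℝ) + 1 ≤ N := by exact_mod_cast hi.2
    exact hsub _ _ (Nat.cast_nonneg i) (by push_cast; linarith) (by push_cast; linarith)

/-- With `t = log x`, the shell `y ≈ e^i` contributes about `F̄(x) g(t - i - 1) g(i) / g(t)`, by
`hdom` and `hG`; summing over shells leaves the convolution of `g` with itself, at most `B g(t)`.
Smallness comes from the little-o in `hG`, available once `K` is large. -/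
theorem tailNegligible_of_convolution {α : ℝ} (hRV : IsRegVarying α F)
    (htail : tail G =o[atTop] tail F) {g : ℝ → ℝ} {A B T : ℝ} (hT : 0 ≤ T) (hA : 0 < A)
    (hg : ∀ s, 0 ≤ g s) (hgT : ∀ s, T ≤ s → 0 < g s)
    (hcomp : ∀ s t, T ≤ s → T ≤ t → |s - t| ≤ 1 → g s ≤ A * g t)
    (hdom : ∀ s t, T ≤ s → s ≤ t →
      slowPart α F (Real.exp s) * g t ≤ A * g s * slowPart α F (Real.exp t))
    (hconv : ∀ᶠ t in atTop, IntervalIntegrable (fun z => g (t - z) * g z) volume 0 t ∧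
      ∫ z in (0 : ℝ)..t, g (t - z) * g z ≤ B * g t)
    (hG : tail G =o[atTop] fun x => x ^ (-α) * g (Real.log x)) : TailNegligible F G := by
  intro ε hε
  -- One `A` comes from `hdom`, `A ^ 2` from comparing sum and integral, `exp α` from the unit width
  -- of a shell, and `|B| + 1` from the convolution bound, enlarged to be positive.
  set D := Real.exp α * A ^ 3 * (|B| + 1) with hD
  have hDpos : 0 < D := by positivity
  set η := ε / 2 / D with hη
  have hηpos : 0 < η := by positivity
  obtain ⟨x₀, hx₀⟩ := eventually_atTop.1 (hG.bound hηpos)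
  obtain ⟨k, hk⟩ := exists_nat_ge (max T (max x₀ 0))
  have hkT : T ≤ k := (le_max_left _ _).trans hk
  have hkx : x₀ ≤ k := (le_max_left _ _).trans ((le_max_right _ _).trans hk)
  have hGi : ∀ i : ℕ, k ≤ i → tail G (Real.exp i) ≤ η * (Real.exp (-(α * i)) * g i) := by
    intro i hi
    have hi' : (k : ℝ) ≤ i := by exact_mod_cast hi
    have := hx₀ (Real.exp i) (by linarith [Real.add_one_le_exp (i : ℝ)])
    rw [Real.norm_of_nonneg (tail_nonneg _), Real.log_exp, ← Real.exp_mul,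
      Real.norm_of_nonneg (mul_nonneg (Real.exp_pos _).le (hg _))] at this
    convert this using 4
    ring
  refine ⟨Real.exp k, Real.exp_pos _, ?_⟩
  have hend := hRV.eventually_tail_mul_le htail (Real.exp_pos (-T - 1)) (half_pos hε)
  filter_upwards [hend, Real.tendsto_log_atTop.eventually hconv, eventually_gt_atTop 0,
    Real.tendsto_log_atTop.eventually (eventually_ge_atTop (k + T))] with x hx1 hx2 hx0 hx3
  set t := Real.log x with ht
  have hxt : x = Real.exp t := (Real.exp_log hx0).symm
  have hk0 : (0 : ℝ) ≤ k := Nat.cast_nonneg k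
  -- The largest index keeping `t - N ≥ T`. Then `e^N` is at least `x e^(-T-1)`, so the remainder
  -- `Ḡ(e^N)` is negligible by `htail` and regular variation.
  set N := ⌊t - T⌋₊ with hN
  have hN1 : (N : ℝ) ≤ t - T := Nat.floor_le (by linarith)
  have hN2 : t - T < N + 1 := Nat.lt_floor_add_one _
  have hkN : k ≤ N := Nat.le_floor (by linarith)
  have hgt : 0 < g t := hgT t (by linarith)
  refine (setIntegral_tail_div_le_sum hx0.le hkN).trans ?_
  have hlast : tail G (Real.exp N) ≤ ε / 2 * tail F x := by
    refine (tail_antitone ?_).trans hx1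
    rw [hxt, ← Real.exp_add]
    exact Real.exp_le_exp.2 (by linarith)
  have hterm : ∀ i ∈ Finset.Ico k N, tail F (x / Real.exp (i + 1)) * tail G (Real.exp i) ≤
      (η * Real.exp α * A * tail F x / g t) * (g (t - i - 1) * g i) := by
    intro i hi
    rw [Finset.mem_Ico] at hi
    have h2 : (i : ℝ) + 1 ≤ N := by exact_mod_cast hi.2
    have h3 := hdom (t - i - 1) t (by linarith) (by linarith [(Nat.cast_nonneg i : (0:ℝ) ≤ i)])
    rw [slowPart_exp, slowPart_exp, ← hxt] at h3
    have h4 : x / Real.exp (i + 1) = Real.exp (t - i - 1) := by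
      rw [hxt, ← Real.exp_sub]; ring_nf
    rw [h4]
    have h5 : tail F (Real.exp (t - i - 1)) ≤
        Real.exp (α * (i + 1)) * (A * g (t - i - 1) * tail F x / g t) := by
      rw [← mul_div_assoc, le_div_iff₀ hgt]
      have e1 : Real.exp (α * (i + 1)) * Real.exp (α * (t - i - 1)) = Real.exp (α * t) := by
        rw [← Real.exp_add]; ring_nf
      have hp := Real.exp_pos (α * (t - i - 1))
      refine le_of_mul_le_mul_left ?_ hp
      calc Real.exp (α * (t - i - 1)) * (tail F (Real.exp (t - i - 1)) * g t)
          = Real.exp (α * (t - i - 1)) * tail F (Real.exp (t - i - 1)) * g t := by ring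
        _ ≤ A * g (t - i - 1) * (Real.exp (α * t) * tail F x) := h3
        _ = _ := by rw [← e1]; ring
    have hnn : 0 ≤ Real.exp (α * (i + 1)) * (A * g (t - i - 1) * tail F x / g t) :=
      mul_nonneg (Real.exp_pos _).le
        (div_nonneg (mul_nonneg (mul_nonneg hA.le (hg _)) (tail_nonneg _)) hgt.le)
    refine (mul_le_mul h5 (hGi i hi.1) (tail_nonneg _) hnn).trans_eq ?_
    have e2 : Real.exp (α * (i + 1)) * Real.exp (-(α * i)) = Real.exp α := by
      rw [← Real.exp_add]; ring_nf
    rw [← e2]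
    ring
  have hsum := sum_mul_le_intervalIntegral hA.le hg hcomp (by linarith) hx2.1 hkN hkT
    (by linarith) (by linarith)
  have hB : ∫ z in (0 : ℝ)..t, g (t - z) * g z ≤ (|B| + 1) * g t :=
    hx2.2.trans (mul_le_mul_of_nonneg_right (by linarith [le_abs_self B]) hgt.le)
  have hcoef : 0 ≤ η * Real.exp α * A * tail F x / g t :=
    div_nonneg (mul_nonneg (by positivity) (tail_nonneg _)) hgt.le
  have hmain : ∑ i ∈ Finset.Ico k N, tail F (x / Real.exp (i + 1)) * tail G (Real.exp i) ≤
      ε / 2 * tail F x := by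
    refine (Finset.sum_le_sum hterm).trans ?_
    rw [← Finset.mul_sum]
    calc _ ≤ η * Real.exp α * A * tail F x / g t * (A ^ 2 * ((|B| + 1) * g t)) :=
          mul_le_mul_of_nonneg_left (hsum.trans (mul_le_mul_of_nonneg_left hB (sq_nonneg A))) hcoef
      _ = η * D * tail F x := by rw [hD]; field_simp
      _ = ε / 2 * tail F x := by rw [hη]; field_simp
  linarith

end Exponential

/-! ### Negligibility under (DZ2) and (DZ3) -/

section ExponentialConditions

theorem IsSubexpDensity.exists_convolution_le {f : ℝ → ℝ} (hf : IsSubexpDensity f) :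
    ∃ B : ℝ, ∀ᶠ t in atTop, IntervalIntegrable (fun z => f (t - z) * f z) volume 0 t ∧
      ∫ z in (0 : ℝ)..t, f (t - z) * f z ≤ B * f t := by
  have hpos : 0 < ∫ u in Set.Ioi (0 : ℝ), f u := by
    rw [setIntegral_pos_iff_support_of_nonneg_ae (Eventually.of_forall hf.nonneg) hf.integrableOn]
    obtain ⟨T, hT⟩ := eventually_atTop.1 hf.eventually_pos
    have hsub : Set.Ioi (max T 0) ⊆ Function.support f ∩ Set.Ioi 0 := fun x hx =>
      ⟨(hT x ((le_max_left _ _).trans (le_of_lt hx))).ne', (le_max_right T 0).trans_lt hx⟩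
    refine lt_of_lt_of_le ?_ (measure_mono hsub)
    simp
  refine ⟨2 * (∫ u in Set.Ioi (0 : ℝ), f u) + 1, ?_⟩
  filter_upwards [hf.tendsto_conv.eventually_lt_const (lt_add_one _),
    hf.tendsto_conv.eventually_ne (by positivity), hf.eventually_pos] with t h1 h2 h3
  have heq : ∀ z, f (t - z) * f z = f t * (f (t - z) / f t * f z) := fun z => by field_simp
  simp_rw [heq]
  constructor
  · refine IntervalIntegrable.const_mul ?_ _
    -- A non-integrable integrand has integral `0` by convention, while these integrals have a
    -- positive limit.
    by_contra h
    exact h2 (intervalIntegral.integral_undef h)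
  · rw [intervalIntegral.integral_const_mul, mul_comm]
    exact mul_le_mul_of_nonneg_right h1.le h3.le

variable {α : ℝ} {F G : Measure ℝ} [IsProbabilityMeasure F] [IsProbabilityMeasure G]

theorem slowPart_exp_pos (hRV : IsRegVarying α F) (t : ℝ) : 0 < slowPart α F (Real.exp t) := by
  rw [slowPart_exp]; exact mul_pos (Real.exp_pos _) (hRV.tail_pos _)

theorem DZ2.tailNegligible (hRV : IsRegVarying α F) (htail : tail G =o[atTop] tail F)
    (h : DZ2 α F) : TailNegligible F G := by
  obtain ⟨B, hB⟩ := h.2.exists_convolution_le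
  obtain ⟨A, hA, hx⟩ := hRV.exists_tail_mul_le (Real.exp_pos (-1))
  obtain ⟨x₀, hx₀⟩ := eventually_atTop.1 hx
  have hα := hRV.1
  have hexp : 1 ≤ Real.exp α := Real.one_le_exp hα.le
  -- `A` controls a step with `s ≤ t`, `exp α` one with `t ≤ s`; the sum is at least one, which is
  -- what `hdom` requires when `g` is the slowly varying part itself.
  refine tailNegligible_of_convolution (A := A + Real.exp α) (B := B) (T := max 0 x₀)
    (g := fun t => slowPart α F (Real.exp t)) hRV htail (le_max_left _ _) (by positivity)
    (fun s => (slowPart_exp_pos hRV s).le) (fun s _ => slowPart_exp_pos hRV s) ?_ ?_ hB ?_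
  · intro s t hs ht hst
    have hst' := abs_le.1 hst
    rw [slowPart_exp, slowPart_exp]
    have hF := tail_nonneg (μ := F) (Real.exp t)
    rcases le_total s t with hle | hle
    · have h1 : tail F (Real.exp s) ≤ A * tail F (Real.exp t) := by
        have h2 : x₀ ≤ Real.exp (s + 1) := by
          linarith [Real.add_one_le_exp (s + 1), (le_max_right 0 x₀).trans hs]
        have h3 := hx₀ _ h2
        rw [← Real.exp_add, add_neg_cancel_right] at h3
        exact h3.trans (mul_le_mul_of_nonneg_left
          (tail_antitone (Real.exp_le_exp.2 (by linarith))) hA.le)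
      calc Real.exp (α * s) * tail F (Real.exp s)
          ≤ Real.exp (α * t) * (A * tail F (Real.exp t)) :=
            mul_le_mul (Real.exp_le_exp.2 (by gcongr)) h1 (tail_nonneg _) (Real.exp_pos _).le
        _ = A * (Real.exp (α * t) * tail F (Real.exp t)) := by ring
        _ ≤ _ := by gcongr; linarith
    · calc Real.exp (α * s) * tail F (Real.exp s)
          ≤ Real.exp (α * (t + 1)) * tail F (Real.exp t) :=
            mul_le_mul (Real.exp_le_exp.2 (by gcongr; linarith))
              (tail_antitone (Real.exp_le_exp.2 hle)) (tail_nonneg _) (Real.exp_pos _).le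
        _ = Real.exp α * (Real.exp (α * t) * tail F (Real.exp t)) := by
            rw [mul_add, Real.exp_add, mul_one]; ring
        _ ≤ _ := by gcongr; linarith
  · intro s t hs hst
    have : 1 ≤ A + Real.exp α := by linarith
    have h1 := mul_nonneg (slowPart_exp_pos hRV s).le (slowPart_exp_pos hRV t).le
    nlinarith
  · refine htail.congr' EventuallyEq.rfl ?_
    filter_upwards [eventually_gt_atTop 0] with x hx
    rw [Real.exp_log hx, slowPart, ← mul_assoc, ← Real.rpow_add hx, neg_add_cancel,
      Real.rpow_zero, one_mul]

omit [IsProbabilityMeasure F] in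
-- In logarithmic scale the quotient of `L` by the tail of `U` is `c`, or `c` divided by the tail of
-- `V`. Eventually `c` lies within a factor two of its limit, whence the `4`, and the reciprocal of
-- a tail is nondecreasing.
theorem IsTypeThreeOrFour.exists_slowPart_mul_le {μU : Measure ℝ} [IsProbabilityMeasure μU]
    (h : IsTypeThreeOrFour (slowPart α F) μU) : ∃ T : ℝ, ∀ s t, T ≤ s → s ≤ t →
      slowPart α F (Real.exp s) * tail μU t ≤ 4 * tail μU s * slowPart α F (Real.exp t) := by
  have hc : ∀ (c : ℝ → ℝ) (c₀ : ℝ), 0 < c₀ → Tendsto c atTop (𝓝 c₀) → ∃ T : ℝ,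
      ∀ s t, T ≤ s → s ≤ t → 0 ≤ c (Real.exp t) ∧ c (Real.exp s) ≤ 4 * c (Real.exp t) := by
    intro c c₀ hc₀ hc
    have hc' := hc.comp Real.tendsto_exp_atTop
    obtain ⟨T, hT⟩ := eventually_atTop.1
      ((hc'.eventually_lt_const (show c₀ < 2 * c₀ by linarith)).and
      (hc'.eventually_const_lt (show c₀ / 2 < c₀ by linarith)))
    refine ⟨T, fun s t hs hst => ?_⟩
    have h1 := (hT s hs).1
    have h2 := (hT t (hs.trans hst)).2
    simp only [Function.comp] at h1 h2
    exact ⟨by linarith, by linarith⟩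
  rcases h with ⟨hU, c, c₀, hc₀, hct, hL⟩ | ⟨μV, hV', hU, hV, c, c₀, hc₀, hct, hL⟩
  · obtain ⟨T, hT⟩ := hc c c₀ hc₀ hct
    refine ⟨T, fun s t hs hst => ?_⟩
    rw [hL _ (Real.exp_pos s), hL _ (Real.exp_pos t), Real.log_exp, Real.log_exp]
    have := mul_le_mul_of_nonneg_right (hT s t hs hst).2
      (mul_nonneg (tail_nonneg (μ := μU) s) (tail_nonneg (μ := μU) t))
    linarith
  · obtain ⟨T, hT⟩ := hc c c₀ hc₀ hct
    refine ⟨T, fun s t hs hst => ?_⟩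
    rw [hL _ (Real.exp_pos s), hL _ (Real.exp_pos t), Real.log_exp, Real.log_exp]
    have h1 : c (Real.exp s) / tail μV s ≤ 4 * c (Real.exp t) / tail μV t :=
      div_le_div₀ (by linarith [(hT s t hs hst).1]) (hT s t hs hst).2 (hV.tail_pos t)
        (tail_antitone hst)
    have h2 := mul_le_mul_of_nonneg_right h1
      (mul_nonneg (tail_nonneg (μ := μU) s) (tail_nonneg (μ := μU) t))
    calc _ = c (Real.exp s) / tail μV s * (tail μU s * tail μU t) := by ring
      _ ≤ _ := h2
      _ = _ := by ring

theorem DZ3.tailNegligible (hRV : IsRegVarying α F) (htail : tail G =o[atTop] tail F)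
    (h : DZ3 α F G) : TailNegligible F G := by
  obtain ⟨μU, hprob, htype, hstar, hG⟩ := h
  have hU : IsLongTailed μU := by
    rcases htype with h | ⟨_, _, h⟩
    exacts [h.1, h.1]
  obtain ⟨B, hB⟩ := hstar.exists_convolution_le
  obtain ⟨T, hT⟩ := htype.exists_slowPart_mul_le
  obtain ⟨x₀, hx₀⟩ := eventually_atTop.1
    ((hU 1).eventually_const_lt (show (1 / 4 : ℝ) < 1 by norm_num))
  refine tailNegligible_of_convolution (A := 4) (B := B) (T := max 0 (max T x₀))
    (g := tail μU) hRV htail (le_max_left _ _) (by norm_num)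
    tail_nonneg (fun s _ => hU.tail_pos s) ?_ ?_ hB hG
  · intro s t hs ht hst
    have hst' := abs_le.1 hst
    have h1 := hx₀ s (((le_max_right _ _).trans (le_max_right _ _)).trans hs)
    rw [lt_div_iff₀ (hU.tail_pos s)] at h1
    have h2 : tail μU t ≥ tail μU (s + 1) := tail_antitone (by linarith)
    linarith
  · exact fun s t hs => hT s t (((le_max_left _ _).trans (le_max_right _ _)).trans hs)

end ExponentialConditions

/-! ### Negligibility under (DZ4) -/

section MomentCondition

theorem measureReal_prod_eq_integral_left (μ ν : Measure ℝ) [IsFiniteMeasure μ] [IsFiniteMeasure ν]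
    {S : Set (ℝ × ℝ)} (hS : MeasurableSet S) :
    (μ.prod ν).real S = ∫ x, ν.real (Prod.mk x ⁻¹' S) ∂μ := by
  simp only [Measure.real]
  rw [Measure.prod_apply hS, integral_toReal (measurable_measure_prodMk_left hS).aemeasurable]
  exact Eventually.of_forall fun _ => measure_lt_top _ _

theorem measureReal_prod_eq_integral_right (μ ν : Measure ℝ) [IsFiniteMeasure μ]
    [IsFiniteMeasure ν] {S : Set (ℝ × ℝ)} (hS : MeasurableSet S) :
    (μ.prod ν).real S = ∫ y, μ.real ((fun x => (x, y)) ⁻¹' S) ∂ν := by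
  simp only [Measure.real]
  rw [Measure.prod_apply_symm hS, integral_toReal (measurable_measure_prodMk_right hS).aemeasurable]
  exact Eventually.of_forall fun _ => measure_lt_top _ _

theorem tendsto_setIntegral_Ioi_zero {μ : Measure ℝ} {f : ℝ → ℝ} (hf : Integrable f μ) :
    Tendsto (fun K : ℝ => ∫ y in Set.Ioi K, f y ∂μ) atTop (𝓝 0) := by
  have h := tendsto_setIntegral_of_antitone (μ := μ) (f := f) (s := fun x : ℝ => Set.Ioi x)
    (fun _ => measurableSet_Ioi) (fun _ _ h => Set.Ioi_subset_Ioi h)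
    ⟨0, hf.integrableOn⟩
  have h0 : (⋂ x : ℝ, Set.Ioi x) = ∅ := by
    ext z
    simp only [Set.mem_iInter, Set.mem_Ioi, Set.mem_empty_iff_false, iff_false, not_forall, not_lt]
    exact ⟨z, le_rfl⟩
  rwa [h0, setIntegral_empty] at h

variable {α : ℝ} {F G : Measure ℝ} [IsProbabilityMeasure F] [IsProbabilityMeasure G]

theorem integrableOn_rpow_Icc (hα : 0 < α) (x : ℝ) :
    IntegrableOn (fun v : ℝ => v ^ α) (Set.Icc 0 x) F :=
  ContinuousOn.integrableOn_compact isCompact_Icc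
    (Real.continuous_rpow_const hα.le).continuousOn

theorem truncMoment_mono (hα : 0 < α) : Monotone (truncMoment α F) := fun _ y hxy =>
  setIntegral_mono_set (integrableOn_rpow_Icc hα y)
    (ae_restrict_of_forall_mem measurableSet_Icc fun _ hv => Real.rpow_nonneg hv.1 _)
    (Set.Icc_subset_Icc_right hxy).eventuallyLE

/-- The slowly varying part of a regularly varying tail is dominated by the truncated moment. -/
theorem exists_rpow_mul_tail_le_truncMoment (hRV : IsRegVarying α F) :
    ∃ E > 0, ∀ᶠ s in atTop, s ^ α * tail F s ≤ E * truncMoment α F s := by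
  have hα := hRV.1
  -- With `2^(-α) < q < 1`, eventually `F̄(s) ≤ q F̄(s/2)`. So `(s/2, s]` has mass at least `(1 - q)
  -- F̄(s)`, and there `v^α ≥ (s/2)^α`.
  have h2 : (2 : ℝ) ^ (-α) < 1 := Real.rpow_lt_one_of_one_lt_of_neg one_lt_two (by linarith)
  obtain ⟨q, hq1, hq2⟩ := exists_between h2
  have hhalf : Tendsto (fun s : ℝ => s / 2) atTop atTop := tendsto_id.atTop_div_const two_pos
  have hp : (0 : ℝ) < 2 ^ α := by positivity
  refine ⟨2 ^ α / (1 - q), div_pos hp (by linarith), ?_⟩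
  filter_upwards [hhalf.eventually ((hRV.2 2 two_pos).eventually_lt_const hq1),
    eventually_gt_atTop 0] with s hs hs0
  rw [div_lt_iff₀ (hRV.tail_pos _), div_mul_cancel₀ s two_ne_zero] at hs
  have hle : s / 2 ≤ s := by linarith
  have hm : (s / 2) ^ α * (tail F (s / 2) - tail F s) ≤ truncMoment α F s := by
    have hdiff : tail F (s / 2) - tail F s = F.real (Set.Ioc (s / 2) s) := by
      rw [tail, tail, ← Set.Ioc_union_Ioi_eq_Ioi hle,
        measureReal_union (Set.Ioc_disjoint_Ioi le_rfl) measurableSet_Ioi, add_sub_cancel_right]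
    have hsub : Set.Ioc (s / 2) s ⊆ Set.Icc 0 s := fun v hv => ⟨by linarith [hv.1], hv.2⟩
    calc (s / 2) ^ α * (tail F (s / 2) - tail F s)
        = ∫ v in Set.Ioc (s / 2) s, (s / 2) ^ α ∂F := by rw [hdiff]; simp [mul_comm]
      _ ≤ ∫ v in Set.Ioc (s / 2) s, v ^ α ∂F := by
        refine setIntegral_mono_on (integrable_const _).integrableOn
          ((integrableOn_rpow_Icc hα s).mono_set hsub) measurableSet_Ioc fun v hv => ?_
        exact Real.rpow_le_rpow (by linarith) hv.1.le hα.le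
      _ ≤ _ := setIntegral_mono_set (integrableOn_rpow_Icc hα s)
          (ae_restrict_of_forall_mem measurableSet_Icc fun _ hv => Real.rpow_nonneg hv.1 _)
          hsub.eventuallyLE
  rw [Real.div_rpow hs0.le two_pos.le, div_mul_eq_mul_div, div_le_iff₀ hp] at hm
  rw [div_mul_eq_mul_div, le_div_iff₀ (by linarith)]
  have hsα : 0 ≤ s ^ α := Real.rpow_nonneg hs0.le _
  have h3 : (1 - q) * tail F s ≤ tail F (s / 2) - tail F s := by
    have := tail_antitone (μ := F) hle
    nlinarith
  nlinarith [mul_le_mul_of_nonneg_left h3 hsα]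

omit [IsProbabilityMeasure G] in
-- The range `1 ≤ w ≤ √x` is exactly what places `x / w` in `[√x, x]`, where `L` is bounded by a
-- multiple of `L x`.
theorem DZ4.exists_tail_div_le (hRV : IsRegVarying α F) (h : DZ4 α F G) :
    ∃ D > 0, ∀ᶠ x in atTop, ∀ w, 1 ≤ w → w ≤ √x → tail F (x / w) ≤ D * w ^ α * tail F x := by
  obtain ⟨b, hb1, hb2⟩ := exists_between h.2.2
  refine ⟨b.toReal + 1, by positivity, ?_⟩
  filter_upwards [eventually_lt_of_limsup_lt hb1, eventually_gt_atTop 0] with x hx hx0 w hw1 hw2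
  have hw0 : 0 < w := by linarith
  have hsx : √x * √x = x := Real.mul_self_sqrt hx0.le
  have hmem : x / w ∈ Set.Icc √x x := by
    constructor
    · rw [le_div_iff₀ hw0]
      nlinarith [Real.sqrt_nonneg x]
    · exact div_le_self hx0.le hw1
  have h1 : ENNReal.ofReal (slowPart α F (x / w) / slowPart α F x) ≤ b :=
    (le_iSup₂ (f := fun y (_ : y ∈ Set.Icc √x x) =>
      ENNReal.ofReal (slowPart α F y / slowPart α F x)) _ hmem).trans hx.le
  have hxα : 0 < x ^ α := Real.rpow_pos_of_pos hx0 _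
  have hwα : 0 < w ^ α := Real.rpow_pos_of_pos hw0 _
  have hL : 0 < slowPart α F x := mul_pos hxα (hRV.tail_pos x)
  have h2 := (ENNReal.ofReal_le_iff_le_toReal hb2.ne).1 h1
  rw [div_le_iff₀ hL, slowPart, slowPart, Real.div_rpow hx0.le hw0.le, div_mul_eq_mul_div,
    div_le_iff₀ hwα] at h2
  have h3 : tail F (x / w) ≤ b.toReal * w ^ α * tail F x := by
    refine le_of_mul_le_mul_left ?_ hxα
    linarith
  refine h3.trans ?_
  have := tail_nonneg (μ := F) x
  gcongr
  linarith

/-- For `y ≤ √x` the integrand is at most `D y^α F̄(x)` and the moment of `Y` suffices. For `y > √x`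
the roles are exchanged: integrating over `X = v` first, `Ḡ(x/v)` produces `v^α / m(√x)`, whose
integral up to `√x` cancels the truncated moment. -/
theorem DZ4.tailNegligible (hRV : IsRegVarying α F) (htail : tail G =o[atTop] tail F)
    (hmom : Integrable (fun y : ℝ => y ^ α) G) (h : DZ4 α F G) : TailNegligible F G := by
  have hα := hRV.1
  obtain ⟨D, hD, hDx⟩ := h.exists_tail_div_le hRV
  obtain ⟨E, hE, hEx⟩ := exists_rpow_mul_tail_le_truncMoment hRV
  intro ε hε
  -- Four pieces are each allotted `ε / 4`; dividing by `E + 1` makes both `η * D` and `η * D * E`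
  -- small enough.
  set η := ε / 4 / D / (E + 1) with hη
  have hηpos : 0 < η := by positivity
  have hηD : η * D ≤ ε / 4 := by
    have : η * D = ε / 4 / (E + 1) := by rw [hη]; field_simp
    rw [this]; exact div_le_self (by positivity) (by linarith)
  have hηE : η * D * E ≤ ε / 4 := by
    have : η * D * (E + 1) = ε / 4 := by rw [hη]; field_simp
    nlinarith [mul_pos hηpos hD]
  obtain ⟨K, hK1, hK⟩ := (((tendsto_setIntegral_Ioi_zero hmom).eventually_lt_const
    (show 0 < ε / 4 / D by positivity)).and (eventually_ge_atTop 1)).exists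
  refine ⟨K, by linarith, ?_⟩
  obtain ⟨x₁, hx₁⟩ := eventually_atTop.1 ((h.2.1.bound hηpos).and
    (h.1.eventually_gt_atTop 0))
  have hsq := Real.tendsto_sqrt_atTop
  filter_upwards [hDx, hsq.eventually hEx, hsq.eventually (eventually_ge_atTop x₁),
    hsq.eventually (eventually_ge_atTop K), htail.bound (show 0 < ε / 4 by positivity),
    eventually_gt_atTop 0] with x hx1 hx2 hx3 hx4 hx5 hx0
  set s := √x with hs
  have hss : s * s = x := Real.mul_self_sqrt hx0.le
  have hs1 : 1 ≤ s := hK.trans hx4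
  have hs0 : 0 < s := by linarith
  have hGm : ∀ t, s ≤ t → tail G t ≤ η * (tail F t / truncMoment α F s) := by
    intro t ht
    have h1 := (hx₁ t (hx3.trans ht)).1
    have hms : 0 < truncMoment α F s := (hx₁ s hx3).2
    have hmt : 0 < truncMoment α F t := (hx₁ t (hx3.trans ht)).2
    rw [Real.norm_of_nonneg (tail_nonneg _),
      Real.norm_of_nonneg (div_nonneg (tail_nonneg _) hmt.le)] at h1
    refine h1.trans ?_
    have := tail_nonneg (μ := F) t
    have := truncMoment_mono (F := F) hα ht
    gcongr
  have hms : 0 < truncMoment α F s := (hx₁ s hx3).2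
  have hF0 := hRV.tail_pos x
  have hint : Integrable (fun y => tail F (x / y)) G := integrable_tail_div G x
  rw [← Set.Ioc_union_Ioi_eq_Ioi hx4, setIntegral_union (Set.Ioc_disjoint_Ioi le_rfl)
        measurableSet_Ioi hint.integrableOn hint.integrableOn]
  have hpart1 : ∫ y in Set.Ioc K s, tail F (x / y) ∂G ≤ ε / 4 * tail F x := by
    calc ∫ y in Set.Ioc K s, tail F (x / y) ∂G
        ≤ ∫ y in Set.Ioc K s, D * tail F x * y ^ α ∂G :=
          setIntegral_mono_on hint.integrableOn (hmom.const_mul _).integrableOn measurableSet_Ioc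
            fun y hy => (hx1 y (hK.trans hy.1.le) hy.2).trans_eq (by ring)
      _ = D * tail F x * ∫ y in Set.Ioc K s, y ^ α ∂G := by rw [integral_const_mul]
      _ ≤ D * tail F x * (ε / 4 / D) := by
          refine mul_le_mul_of_nonneg_left (le_trans ?_ hK1.le) (by positivity)
          exact setIntegral_mono_set hmom.integrableOn
            (ae_restrict_of_forall_mem measurableSet_Ioi fun y (hy : K < y) =>
              Real.rpow_nonneg (by linarith) _) Set.Ioc_subset_Ioi_self.eventuallyLE
      _ = _ := by field_simp
  set S : Set (ℝ × ℝ) := {p | s < p.2 ∧ x < p.1 * p.2} with hSdef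
  set S₁ : Set (ℝ × ℝ) := {p | (1 < p.1 ∧ p.1 ≤ s) ∧ x < p.1 * p.2} with hS₁def
  have hSm : MeasurableSet S := (measurableSet_lt measurable_const measurable_snd).inter
    (measurableSet_lt measurable_const (measurable_fst.mul measurable_snd))
  have hS₁m : MeasurableSet S₁ := ((measurableSet_lt measurable_const measurable_fst).inter
    (measurableSet_le measurable_fst measurable_const)).inter
    (measurableSet_lt measurable_const (measurable_fst.mul measurable_snd))
  have hSeq : ∫ y in Set.Ioi s, tail F (x / y) ∂G = (F.prod G).real S := by
    rw [measureReal_prod_eq_integral_right F G hSm, ← integral_indicator measurableSet_Ioi]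
    congr 1 with y
    by_cases hy : s < y
    · rw [Set.indicator_of_mem (show y ∈ Set.Ioi s from hy), tail]
      congr 1
      ext v
      simp [hSdef, hy, div_lt_iff₀ (hs0.trans hy)]
    · rw [Set.indicator_of_notMem (show y ∉ Set.Ioi s from hy)]
      simp [hSdef, hy]
  -- According to `v ≤ 1` (which forces `y > x`), `1 < v ≤ s`, or `v > s`.
  have hsub : S ⊆ (Set.univ ×ˢ Set.Ioi x) ∪ (S₁ ∪ Set.Ioi s ×ˢ Set.Ioi s) := by
    rintro ⟨v, y⟩ ⟨h1, h2⟩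
    simp only at h1 h2
    by_cases hv : v ≤ 1
    · left; simp only [Set.mem_prod, Set.mem_univ, true_and, Set.mem_Ioi]; nlinarith
    · right
      by_cases hv2 : v ≤ s
      · left; exact ⟨⟨not_le.1 hv, hv2⟩, h2⟩
      · right; exact ⟨not_le.1 hv2, h1⟩
  have hS₁ : (F.prod G).real S₁ ≤ ε / 4 * tail F x := by
    rw [measureReal_prod_eq_integral_left F G hS₁m]
    have hpt : ∀ v, G.real (Prod.mk v ⁻¹' S₁) ≤ (Set.Icc 0 s).indicator
        (fun v => η * D * tail F x / truncMoment α F s * v ^ α) v := by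
      intro v
      by_cases hv : 1 < v ∧ v ≤ s
      · have hv0 : 0 < v := by linarith [hv.1]
        rw [Set.indicator_of_mem (show v ∈ Set.Icc 0 s from ⟨hv0.le, hv.2⟩)]
        have h1 : Prod.mk v ⁻¹' S₁ = Set.Ioi (x / v) := by
          ext y; simp [hS₁def, hv, div_lt_iff₀ hv0, mul_comm]
        rw [h1]
        have h2 : s ≤ x / v := by rw [le_div_iff₀ hv0]; nlinarith [hv.2]
        calc G.real (Set.Ioi (x / v)) ≤ η * (tail F (x / v) / truncMoment α F s) := hGm _ h2
          _ ≤ η * ((D * v ^ α * tail F x) / truncMoment α F s) := by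
            gcongr; exact hx1 v hv.1.le hv.2
          _ = _ := by ring
      · have h1 : Prod.mk v ⁻¹' S₁ = ∅ := by
          ext y; simp only [hS₁def, Set.mem_preimage, Set.mem_ofPred_eq, hv, false_and,
            Set.mem_empty_iff_false]
        rw [h1, measureReal_empty]
        exact Set.indicator_nonneg (fun v hv => mul_nonneg (by positivity)
          (Real.rpow_nonneg hv.1 _)) v
    calc ∫ v, G.real (Prod.mk v ⁻¹' S₁) ∂F
        ≤ ∫ v, (Set.Icc 0 s).indicator
            (fun v => η * D * tail F x / truncMoment α F s * v ^ α) v ∂F := by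
          refine integral_mono_of_nonneg (Eventually.of_forall fun _ => measureReal_nonneg) ?_
            (Eventually.of_forall hpt)
          exact (integrable_indicator_iff measurableSet_Icc).2
            ((integrableOn_rpow_Icc hα s).const_mul _)
      _ = η * D * tail F x := by
          rw [integral_indicator measurableSet_Icc, integral_const_mul]
          change _ * truncMoment α F s = _
          field_simp
      _ ≤ _ := by gcongr
  have hlast : (F.prod G).real (Set.Ioi s ×ˢ Set.Ioi s) ≤ ε / 4 * tail F x := by
    rw [measureReal_prod_prod]
    have hsα : 0 < s ^ α := Real.rpow_pos_of_pos hs0 _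
    -- Since `x / s = s`, the choice `w = s` bounds `F̄(s)` itself by a multiple of `s^α F̄(x)`.
    have h1 := hx1 s hs1 le_rfl
    rw [← hss, mul_div_cancel_right₀ _ hs0.ne', hss] at h1
    have hFs := tail_nonneg (μ := F) s
    calc tail F s * tail G s ≤ tail F s * (η * (tail F s / truncMoment α F s)) := by
          gcongr; exact hGm s le_rfl
      _ ≤ (D * s ^ α * tail F x) * (η * (tail F s / truncMoment α F s)) := by
          gcongr
      _ = η * D * tail F x * ((s ^ α * tail F s) / truncMoment α F s) := by ring
      _ ≤ η * D * tail F x * E := by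
          gcongr
          rw [div_le_iff₀ hms]; exact hx2
      _ = η * D * E * tail F x := by ring
      _ ≤ _ := by gcongr
  have hfirst : (F.prod G).real (Set.univ ×ˢ Set.Ioi x) ≤ ε / 4 * tail F x := by
    rw [measureReal_prod_prod, probReal_univ, one_mul]
    rwa [Real.norm_of_nonneg (tail_nonneg _), Real.norm_of_nonneg (tail_nonneg _)] at hx5
  have h1 := (measureReal_mono hsub).trans (measureReal_union_le (μ := F.prod G) _ _)
  have h2 := measureReal_union_le (μ := F.prod G) S₁ (Set.Ioi s ×ˢ Set.Ioi s)
  rw [hSeq]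
  linarith

end MomentCondition

/-! ### Single big jump and tails under a density -/

section BigJump

variable {α : ℝ} {F : Measure ℝ} [IsProbabilityMeasure F]

theorem IsRegVarying.tendsto_tail_mul_div (hRV : IsRegVarying α F) {μ : Measure ℝ} {c b : ℝ}
    (hμ : Tendsto (fun x => tail μ x / tail F x) atTop (𝓝 c)) (hb : 0 < b) :
    Tendsto (fun x => tail μ (x * b) / tail F x) atTop (𝓝 (c * b ^ (-α))) := by
  have h := (hμ.comp (tendsto_id.atTop_mul_const hb)).mul (hRV.2 b hb)
  refine h.congr fun x => ?_
  exact div_mul_div_cancel₀ (hRV.tail_pos _).ne'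

theorem tendsto_tail_neg_mul {μ : Measure ℝ} [IsProbabilityMeasure μ] {δ : ℝ} (hδ : 0 < δ) :
    Tendsto (fun x => tail μ (-(x * δ))) atTop (𝓝 1) := by
  have h := tendsto_measure_iUnion_atTop (μ := μ) (s := fun x : ℝ => Set.Ioi (-(x * δ)))
    (fun x y h => Set.Ioi_subset_Ioi (by nlinarith))
  have h0 : (⋃ x : ℝ, Set.Ioi (-(x * δ))) = Set.univ := by
    ext z
    simp only [Set.mem_iUnion, Set.mem_Ioi, Set.mem_univ, iff_true]
    refine ⟨(-z + 1) / δ, ?_⟩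
    rw [div_mul_cancel₀ _ hδ.ne']; linarith
  rw [h0, measure_univ] at h
  exact (ENNReal.tendsto_toReal ENNReal.one_ne_top).comp h

theorem measureReal_lt_add_le (μ ν : Measure ℝ) [IsProbabilityMeasure μ] [IsProbabilityMeasure ν]
    (a b : ℝ) : (μ.prod ν).real {p | a + b < p.1 + p.2} ≤ tail μ a + tail ν b := by
  have hsub : {p : ℝ × ℝ | a + b < p.1 + p.2} ⊆ Set.Ioi a ×ˢ Set.univ ∪ Set.univ ×ˢ Set.Ioi b := by
    rintro ⟨u, v⟩ h
    change a + b < u + v at h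
    by_cases hu : a < u
    · exact Or.inl ⟨hu, trivial⟩
    · exact Or.inr ⟨trivial, show b < v by linarith [not_lt.1 hu]⟩
  refine (measureReal_mono hsub).trans ((measureReal_union_le _ _).trans ?_)
  simp [measureReal_prod_prod, tail]

/-- The principle of a single big jump for two independent variables whose tails are comparable
with a regularly varying one. -/
theorem IsRegVarying.tendsto_measureReal_lt_add (hRV : IsRegVarying α F) {μ ν : Measure ℝ}
    [IsProbabilityMeasure μ] [IsProbabilityMeasure ν] {c d : ℝ}
    (hμ : Tendsto (fun x => tail μ x / tail F x) atTop (𝓝 c))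
    (hν : Tendsto (fun x => tail ν x / tail F x) atTop (𝓝 d)) :
    Tendsto (fun x => (μ.prod ν).real {p | x < p.1 + p.2} / tail F x) atTop (𝓝 (c + d)) := by
  have hcont : ∀ b : ℝ, 0 < b → ContinuousAt (fun b : ℝ => c * b ^ (-α) + d * b ^ (-α)) b :=
    fun b hb => ((Real.continuousAt_rpow_const b _ (Or.inl hb.ne')).const_mul c).add
      ((Real.continuousAt_rpow_const b _ (Or.inl hb.ne')).const_mul d)
  refine tendsto_order.2 ⟨fun l hl => ?_, fun u hu => ?_⟩
  -- Lower bound: for `b > 1` close to one, one variable exceeds `x b` while the other, possibly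
  -- negative, stays above `-x (b - 1)`. The two events overlap only when both variables exceed `x
  -- b`, which is negligible.
  · have h1 : ∀ᶠ b in 𝓝 (1 : ℝ), l < c * b ^ (-α) + d * b ^ (-α) :=
      (hcont 1 one_pos).eventually_const_lt (by simpa using hl)
    obtain ⟨b, hb, hb1⟩ := ((h1.filter_mono nhdsWithin_le_nhds).and
      (self_mem_nhdsWithin : Set.Ioi (1 : ℝ) ∈ 𝓝[>] (1 : ℝ))).exists
    have hb1' : (1 : ℝ) < b := hb1
    have hb0 : 0 < b := by linarith
    have hδ : 0 < b - 1 := by linarith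
    have hA := hRV.tendsto_tail_mul_div hμ hb0
    have hB := hRV.tendsto_tail_mul_div hν hb0
    have hlim := ((hA.mul (tendsto_tail_neg_mul (μ := ν) hδ)).add
      (hB.mul (tendsto_tail_neg_mul (μ := μ) hδ))).sub
      (hA.mul ((tendsto_tail_atTop (μ := ν)).comp (tendsto_id.atTop_mul_const hb0)))
    rw [mul_one, mul_one, mul_zero, sub_zero] at hlim
    filter_upwards [hlim.eventually_const_lt hb, eventually_gt_atTop 0] with x hx hx0
    refine hx.trans_le ?_
    set S := Set.Ioi (x * b) ×ˢ Set.Ioi (-(x * (b - 1))) with hS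
    set S' := Set.Ioi (-(x * (b - 1))) ×ˢ Set.Ioi (x * b) with hS'
    have hsub : S ∪ S' ⊆ {p : ℝ × ℝ | x < p.1 + p.2} := by
      rintro ⟨u, v⟩ (⟨h1, h2⟩ | ⟨h1, h2⟩) <;>
      · change _ < u at h1
        change _ < v at h2
        change x < u + v
        linarith
    have hinter : S ∩ S' ⊆ Set.Ioi (x * b) ×ˢ Set.Ioi (x * b) := fun p hp =>
      ⟨hp.1.1, hp.2.2⟩
    have h1 := measureReal_union_add_inter (μ := μ.prod ν) (s := S) (t := S')
      (measurableSet_Ioi.prod measurableSet_Ioi)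
    have h2 := measureReal_mono (μ := μ.prod ν) hsub
    have h3 := measureReal_mono (μ := μ.prod ν) hinter
    rw [hS, hS'] at h1
    rw [measureReal_prod_prod, measureReal_prod_prod] at h1
    rw [measureReal_prod_prod] at h3
    have hF := hRV.tail_pos x
    rw [le_div_iff₀ hF]
    simp only [Function.comp, id]
    have : (tail μ (x * b) / tail F x * tail ν (-(x * (b - 1))) +
        tail ν (x * b) / tail F x * tail μ (-(x * (b - 1))) -
        tail μ (x * b) / tail F x * tail ν (x * b)) * tail F x =
        tail μ (x * b) * tail ν (-(x * (b - 1))) + tail μ (-(x * (b - 1))) * tail ν (x * b)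
          - tail μ (x * b) * tail ν (x * b) := by field_simp
    rw [this]
    simp only [tail] at *
    linarith
  -- Upper bound: for `b < 1` close to one, either some variable exceeds `x b` or both exceed `x (1
  -- - b)`; the latter is a product of two tails, hence negligible.
  · have h1 : ∀ᶠ b in 𝓝 (1 : ℝ), c * b ^ (-α) + d * b ^ (-α) < u :=
      (hcont 1 one_pos).eventually_lt_const (by simpa using hu)
    obtain ⟨b, hb, hb0, hb1⟩ := ((h1.filter_mono nhdsWithin_le_nhds).and
      (Ioo_mem_nhdsLT (zero_lt_one (α := ℝ)))).exists
    have hδ : 0 < 1 - b := by linarith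
    have hA := hRV.tendsto_tail_mul_div hμ hb0
    have hB := hRV.tendsto_tail_mul_div hν hb0
    have hC := hRV.tendsto_tail_mul_div hμ hδ
    have hlim := (hA.add hB).add
      (hC.mul ((tendsto_tail_atTop (μ := ν)).comp (tendsto_id.atTop_mul_const hδ)))
    rw [mul_zero, add_zero] at hlim
    filter_upwards [hlim.eventually_lt_const hb, eventually_gt_atTop 0] with x hx hx0
    refine lt_of_le_of_lt ?_ hx
    have hF := hRV.tail_pos x
    rw [div_le_iff₀ hF]
    have hsub : {p : ℝ × ℝ | x < p.1 + p.2} ⊆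
        (Set.Ioi (x * b) ×ˢ Set.univ ∪ Set.univ ×ˢ Set.Ioi (x * b)) ∪
          Set.Ioi (x * (1 - b)) ×ˢ Set.Ioi (x * (1 - b)) := by
      rintro ⟨p, q⟩ h
      change x < p + q at h
      by_cases hp : x * b < p
      · exact Or.inl (Or.inl ⟨hp, trivial⟩)
      by_cases hq : x * b < q
      · exact Or.inl (Or.inr ⟨trivial, hq⟩)
      exact Or.inr ⟨show x * (1 - b) < p by linarith, show x * (1 - b) < q by linarith⟩
    have h1 := measureReal_mono (μ := μ.prod ν) hsub
    have h2 := measureReal_union_le (μ := μ.prod ν)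
      (Set.Ioi (x * b) ×ˢ Set.univ ∪ Set.univ ×ˢ Set.Ioi (x * b))
      (Set.Ioi (x * (1 - b)) ×ˢ Set.Ioi (x * (1 - b)))
    have h3 := measureReal_union_le (μ := μ.prod ν)
      (Set.Ioi (x * b) ×ˢ Set.univ) (Set.univ ×ˢ Set.Ioi (x * b))
    rw [measureReal_prod_prod, measureReal_prod_prod, probReal_univ, probReal_univ] at h3
    rw [measureReal_prod_prod (s := Set.Ioi (x * (1 - b)))] at h2
    simp only [Function.comp, id]
    have : (tail μ (x * b) / tail F x + tail ν (x * b) / tail F x +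
        tail μ (x * (1 - b)) / tail F x * tail ν (x * (1 - b))) * tail F x =
        tail μ (x * b) + tail ν (x * b) + tail μ (x * (1 - b)) * tail ν (x * (1 - b)) := by
      field_simp
    rw [this]
    simp only [tail] at *
    linarith

theorem measureReal_withDensity_ofReal {μ : Measure ℝ} {f : ℝ → ℝ} (hf : Integrable f μ)
    (hf0 : ∀ᵐ u ∂μ, 0 ≤ f u) {s : Set ℝ} (hs : MeasurableSet s) :
    (μ.withDensity fun u => ENNReal.ofReal (f u)).real s = ∫ u in s, f u ∂μ := by
  rw [Measure.real, withDensity_apply _ hs,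
    ← ofReal_integral_eq_lintegral_ofReal hf.integrableOn (ae_restrict_of_ae hf0),
    ENNReal.toReal_ofReal (integral_nonneg_of_ae (ae_restrict_of_ae hf0))]

theorem tendsto_tail_withDensity_div {μ : Measure ℝ} [IsFiniteMeasure μ] {f : ℝ → ℝ} {l : ℝ}
    (hμ : ∀ x, 0 < tail μ x) (hf : Integrable f μ)
    (hf0 : ∀ᵐ u ∂μ, 0 ≤ f u) (hl : Tendsto f atTop (𝓝 l)) :
    Tendsto (fun x => tail (μ.withDensity fun u => ENNReal.ofReal (f u)) x / tail μ x) atTop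
      (𝓝 l) := by
  rw [Metric.tendsto_atTop']
  intro ε hε
  obtain ⟨T, hT⟩ := (Metric.tendsto_atTop'.1 hl) (ε / 2) (half_pos hε)
  refine ⟨T, fun x hx => ?_⟩
  rw [tail, measureReal_withDensity_ofReal hf hf0 measurableSet_Ioi, Real.dist_eq]
  have h1 : (∫ u in Set.Ioi x, f u ∂μ) - l * tail μ x = ∫ u in Set.Ioi x, (f u - l) ∂μ := by
    rw [integral_sub hf.integrableOn (integrable_const _).integrableOn]
    simp [tail, mul_comm]
  have h2 : ‖∫ u in Set.Ioi x, (f u - l) ∂μ‖ ≤ ε / 2 * μ.real (Set.Ioi x) :=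
    norm_setIntegral_le_of_norm_le_const (measure_lt_top _ _) fun u hu => by
      rw [← dist_eq_norm]; exact (hT u (hx.trans hu)).le
  rw [← h1, Real.norm_eq_abs] at h2
  have hp := hμ x
  rw [div_sub' hp.ne', abs_div, abs_of_pos hp, div_lt_iff₀ hp, mul_comm (tail μ x)]
  refine h2.trans_lt ?_
  exact mul_lt_mul_of_pos_right (by linarith) hp

end BigJump

/-! ### Mixing over the multiplier -/

section Mixture

variable {α : ℝ} {F G : Measure ℝ} [IsProbabilityMeasure F] [IsProbabilityMeasure G]

/-- Dominated convergence for mixtures of tails over the law of the multiplier. -/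
theorem TailNegligible.tendsto_integral_div (hN : TailNegligible F G) (hRV : IsRegVarying α F)
    {J : ℝ → ℝ → ℝ} {l : ℝ → ℝ} {C : ℝ} (hC : 0 ≤ C)
    (hJm : ∀ x, AEStronglyMeasurable (J x) G)
    (hJ0 : ∀ᵐ y ∂G, y ≤ 0 → ∀ x, 0 < x → J x y = 0)
    (hJle : ∀ᵐ y ∂G, 0 < y → ∀ x, ‖J x y‖ ≤ C * tail F (x / y))
    (hlim : ∀ᵐ y ∂G, Tendsto (fun x => J x y / tail F x) atTop (𝓝 (l y)))
    (hl : Integrable l G) :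
    Tendsto (fun x => (∫ y, J x y ∂G) / tail F x) atTop (𝓝 (∫ y, l y ∂G)) := by
  have hJint : ∀ x, 0 < x → Integrable (J x) G := fun x hx => by
    refine Integrable.of_bound (hJm x) C ?_
    filter_upwards [hJ0, hJle] with y h1 h2
    rcases le_or_gt y 0 with hy | hy
    · rw [h1 hy x hx, norm_zero]; exact hC
    · exact (h2 hy x).trans (mul_le_of_le_one_right hC (tail_le_one _))
  rw [Metric.tendsto_atTop']
  intro ε hε
  obtain ⟨K₀, hK₀, hKN⟩ := hN (ε / 4 / (C + 1)) (by positivity)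
  obtain ⟨K, hKl, hKK⟩ := ((Metric.tendsto_nhds.1 (tendsto_setIntegral_Ioi_zero hl) (ε / 4)
    (by positivity)).and (eventually_ge_atTop K₀)).exists
  rw [dist_zero_right] at hKl
  have hK : 0 < K := hK₀.trans_le hKK
  obtain ⟨A, hA, hAx⟩ := hRV.exists_tail_mul_le (inv_pos.2 hK)
  have hcore : Tendsto (fun x => ∫ y in Set.Iic K, J x y / tail F x ∂G) atTop
      (𝓝 (∫ y in Set.Iic K, l y ∂G)) := by
    -- For `0 < y ≤ K` one has `x / y ≥ x / K`, so the ratio is at most `C * A`.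
    refine tendsto_integral_filter_of_dominated_convergence (fun _ => C * A)
      (Eventually.of_forall fun x =>
        ((hJm x).aemeasurable.div_const _).aestronglyMeasurable.restrict) ?_ (integrable_const _)
      (ae_restrict_of_ae hlim)
    filter_upwards [hAx, eventually_gt_atTop 0] with x hx hx0
    filter_upwards [ae_restrict_of_ae hJ0, ae_restrict_of_ae hJle,
      ae_restrict_mem measurableSet_Iic] with y h1 h2 hyK
    rcases le_or_gt y 0 with hy | hy
    · rw [h1 hy x hx0, zero_div, norm_zero]; positivity
    · have hF := hRV.tail_pos x
      rw [norm_div, Real.norm_of_nonneg hF.le, div_le_iff₀ hF, mul_assoc]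
      refine (h2 hy x).trans (mul_le_mul_of_nonneg_left (le_trans ?_ hx) hC)
      refine tail_antitone ?_
      rw [← div_eq_mul_inv]
      exact div_le_div_of_nonneg_left hx0.le hy hyK
  obtain ⟨x₀, hx₀⟩ := eventually_atTop.1 ((Metric.tendsto_nhds.1 hcore (ε / 4) (by positivity)).and
    (hKN.and (eventually_gt_atTop 0)))
  refine ⟨x₀, fun x hx => ?_⟩
  obtain ⟨h1, h2, hx0⟩ := hx₀ x hx.le
  have hF := hRV.tail_pos x
  have hsplit : ∀ f : ℝ → ℝ, Integrable f G →
      ∫ y, f y ∂G = ∫ y in Set.Iic K, f y ∂G + ∫ y in Set.Ioi K, f y ∂G := fun f hf => by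
    rw [← Set.compl_Iic, integral_add_compl measurableSet_Iic hf]
  have h3 : ‖∫ y in Set.Ioi K, J x y / tail F x ∂G‖ ≤ ε / 4 := by
    rw [integral_div, norm_div, Real.norm_of_nonneg hF.le, div_le_iff₀ hF]
    have hint : Integrable (fun y => tail F (x / y)) G := integrable_tail_div G x
    calc ‖∫ y in Set.Ioi K, J x y ∂G‖ ≤ ∫ y in Set.Ioi K, C * tail F (x / y) ∂G := by
          refine norm_integral_le_of_norm_le (hint.const_mul C).integrableOn ?_
          filter_upwards [ae_restrict_of_ae hJle, ae_restrict_mem measurableSet_Ioi] with y h hy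
          exact h (hK.trans hy) x
      _ = C * ∫ y in Set.Ioi K, tail F (x / y) ∂G := integral_const_mul _ _
      _ ≤ C * ∫ y in Set.Ioi K₀, tail F (x / y) ∂G := by
          refine mul_le_mul_of_nonneg_left ?_ hC
          exact setIntegral_mono_set hint.integrableOn (Eventually.of_forall fun _ => tail_nonneg _)
            (Set.Ioi_subset_Ioi hKK).eventuallyLE
      _ ≤ (C + 1) * (ε / 4 / (C + 1) * tail F x) :=
          mul_le_mul (by linarith) h2 (integral_nonneg fun _ => tail_nonneg _) (by positivity)
      _ = ε / 4 * tail F x := by field_simp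
  rw [← integral_div, hsplit _ ((hJint x hx0).div_const _), hsplit l hl, dist_eq_norm]
  rw [dist_eq_norm] at h1
  calc _ = ‖((∫ y in Set.Iic K, J x y / tail F x ∂G) - ∫ y in Set.Iic K, l y ∂G) +
        (∫ y in Set.Ioi K, J x y / tail F x ∂G) - ∫ y in Set.Ioi K, l y ∂G‖ := by
          congr 1; ring
    _ ≤ _ := norm_sub_le _ _
    _ ≤ ε / 4 + ε / 4 + ε / 4 := by
      refine add_le_add ((norm_add_le _ _).trans (add_le_add h1.le h3)) hKl.le
    _ < ε := by linarith

/-- The density of the Sarmanov law with respect to the product of its marginals. -/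
noncomputable def sarmanovDensity (θ : ℝ) (φ₁ φ₂ : ℝ → ℝ) (p : ℝ × ℝ) : ℝ≥0∞ :=
  ENNReal.ofReal (1 + θ * φ₁ p.1 * φ₂ p.2)

variable {ν : Measure ℝ} [IsProbabilityMeasure ν] {θ d₁ c : ℝ} {φ₁ φ₂ : ℝ → ℝ}

omit [IsProbabilityMeasure ν] in
-- Used for the dominating function: a sum exceeding `t` has a term exceeding `t / 2`.
theorem exists_tail_half_le (hRV : IsRegVarying α F)
    (hν : Tendsto (fun x => tail ν x / tail F x) atTop (𝓝 c)) (B : ℝ) (hB : 0 ≤ B) :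
    ∃ C ≥ 0, ∃ T, ∀ t ≥ T, B * tail F (t / 2) + tail ν (t / 2) ≤ C * tail F t := by
  obtain ⟨A, hA, hAx⟩ := hRV.exists_tail_mul_le (show (0 : ℝ) < 1 / 2 by norm_num)
  have h1 := hRV.tendsto_tail_mul_div hν (show (0 : ℝ) < 1 / 2 by norm_num)
  set e := c * (1 / 2 : ℝ) ^ (-α) with he
  obtain ⟨T, hT⟩ := eventually_atTop.1 (hAx.and (h1.eventually_lt_const (lt_add_one e)))
  refine ⟨B * A + |e| + 1, by positivity, T, fun t ht => ?_⟩
  obtain ⟨h2, h3⟩ := hT t ht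
  have hF := hRV.tail_pos t
  rw [div_lt_iff₀ hF] at h3
  rw [show t / 2 = t * (1 / 2) by ring]
  have h4 := mul_le_mul_of_nonneg_left h2 hB
  have h5 := mul_le_mul_of_nonneg_right (le_abs_self e) hF.le
  linarith

/-- The tail of `Y (X + M)` for a Sarmanov vector `(X, Y)` and an independent `M` with a tail
proportional to that of `X`. -/
theorem tendsto_tail_mul_add_div (hRV : IsRegVarying α F) (hN : TailNegligible F G)
    (hG0 : ∀ᵐ y ∂G, 0 ≤ y)
    (hφ₁ : Measurable φ₁) (hφ₂ : Measurable φ₂) (hint : Integrable φ₁ F) (hmean : ∫ u, φ₁ u ∂F = 0)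
    (hpos : ∀ᵐ y ∂G, ∀ᵐ u ∂F, 0 ≤ 1 + θ * φ₁ u * φ₂ y) {B : ℝ}
    (hB : ∀ᵐ y ∂G, ∀ᵐ u ∂F, 1 + θ * φ₁ u * φ₂ y ≤ B) (hd : Tendsto φ₁ atTop (𝓝 d₁))
    (hν : Tendsto (fun x => tail ν x / tail F x) atTop (𝓝 c))
    (hl : Integrable (fun y => (1 + θ * d₁ * φ₂ y + c) * y ^ α) G) :
    Tendsto (fun x => (((F.prod G).withDensity (sarmanovDensity θ φ₁ φ₂)).prod ν).real
      {q | x < q.1.2 * (q.1.1 + q.2)} / tail F x) atTop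
      (𝓝 (∫ y, (1 + θ * d₁ * φ₂ y + c) * y ^ α ∂G)) := by
  have hα := hRV.1
  have hκ : Measurable (sarmanovDensity θ φ₁ φ₂) := by
    unfold sarmanovDensity; fun_prop
  set Fy : ℝ → Measure ℝ := fun y => F.withDensity fun u => ENNReal.ofReal (1 + θ * φ₁ u * φ₂ y)
    with hFy
  have hfint : ∀ y, Integrable (fun u => 1 + θ * φ₁ u * φ₂ y) F := fun y =>
    (integrable_const _).add ((hint.const_mul θ).mul_const _)
  -- `Fy y` is the conditional law of `X` given `Y = y`; it has mass one because `φ₁` is centred.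
  have hprob : ∀ᵐ y ∂G, IsProbabilityMeasure (Fy y) := by
    filter_upwards [hpos] with y hy
    refine ⟨?_⟩
    rw [hFy, withDensity_apply _ MeasurableSet.univ, Measure.restrict_univ,
      ← ofReal_integral_eq_lintegral_ofReal (hfint y) hy,
      integral_add (integrable_const _) ((hint.const_mul θ).mul_const _), integral_mul_const,
      integral_const_mul, hmean]
    simp
  set A : ℝ → ℝ → Set (ℝ × ℝ) := fun x y => {p | x < y * (p.1 + p.2)} with hAdef
  -- The conditional probability as a lower integral, a form in which measurability in `y` is
  -- immediate.
  set I : ℝ → ℝ → ℝ≥0∞ := fun x y =>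
    ∫⁻ u, sarmanovDensity θ φ₁ φ₂ (u, y) * ν {m | x < y * (u + m)} ∂F with hI
  have hAm : ∀ x, MeasurableSet {q : (ℝ × ℝ) × ℝ | x < q.1.2 * (q.1.1 + q.2)} := fun x =>
    measurableSet_lt measurable_const (by fun_prop)
  have hslice : ∀ x, Measurable fun p : ℝ × ℝ => ν {m | x < p.2 * (p.1 + m)} := fun x =>
    measurable_measure_prodMk_left (ν := ν) (hAm x)
  have hIm : ∀ x, Measurable (I x) := fun x =>
    Measurable.lintegral_prod_left' (hκ.mul (hslice x))
  have hIeq : ∀ x y, I x y = ((Fy y).prod ν) (A x y) := fun x y => by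
    rw [Measure.prod_apply (measurableSet_lt measurable_const (by fun_prop)), hFy,
      lintegral_withDensity_eq_lintegral_mul _ (by fun_prop)]
    · rfl
    · exact (hslice x).comp (measurable_id.prodMk measurable_const)
  have htot : ∀ x, (((F.prod G).withDensity (sarmanovDensity θ φ₁ φ₂)).prod ν).real
      {q | x < q.1.2 * (q.1.1 + q.2)} = ∫ y, ((Fy y).prod ν).real (A x y) ∂G := fun x => by
    simp only [Measure.real, ← hIeq]
    rw [integral_toReal (hIm x).aemeasurable, Measure.prod_apply (hAm x)]
    · change (∫⁻ p, (fun p : ℝ × ℝ => ν {m | x < p.2 * (p.1 + m)}) p ∂_).toReal = _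
      rw [lintegral_withDensity_eq_lintegral_mul _ hκ (hslice x),
        lintegral_prod_symm' _ (hκ.mul (hslice x))]
      rfl
    · filter_upwards [hprob] with y hy
      rw [hIeq]; exact measure_lt_top _ _
  simp_rw [htot]
  obtain ⟨C, hC, T, hCT⟩ := exists_tail_half_le hRV hν (max B 0) (le_max_right _ _)
  have hFT := hRV.tail_pos T
  have hApos : ∀ x y, 0 < y → A x y = {p | x / y < p.1 + p.2} := fun x y hy => by
    ext p; simp [hAdef, div_lt_iff₀ hy, mul_comm]
  -- `C` serves for `x / y ≥ T`; below `T` the probability is at most one, and `F̄(x/y) ≥ F̄(T)`.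
  refine hN.tendsto_integral_div hRV (C := C + 1 / tail F T) (by positivity) ?_ ?_ ?_ ?_ hl
  · intro x
    simp only [Measure.real, ← hIeq]
    exact (hIm x).ennreal_toReal.aestronglyMeasurable
  · filter_upwards [hG0] with y hy hy' x hx
    have : A x y = ∅ := by
      ext p; simp [hAdef, le_antisymm hy' hy, hx.le]
    rw [this, measureReal_empty]
  · filter_upwards [hprob, hpos, hB] with y hy hy0 hyB hypos x
    rw [hApos x y hypos, Real.norm_of_nonneg measureReal_nonneg]
    have hnn := tail_nonneg (μ := F) (x / y)
    rcases le_total T (x / y) with ht | ht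
    · have h1 := measureReal_lt_add_le (Fy y) ν (x / y / 2) (x / y / 2)
      rw [add_halves] at h1
      have h2 : tail (Fy y) (x / y / 2) ≤ max B 0 * tail F (x / y / 2) := by
        rw [tail, hFy, measureReal_withDensity_ofReal (hfint y) hy0 measurableSet_Ioi]
        calc _ ≤ ∫ u in Set.Ioi (x / y / 2), max B 0 ∂F := by
              refine setIntegral_mono_ae (hfint y).integrableOn
                (integrable_const _).integrableOn ?_
              filter_upwards [hyB] with u hu
              exact hu.trans (le_max_left _ _)
          _ = _ := by simp [tail, mul_comm]
      calc _ ≤ C * tail F (x / y) := by linarith [hCT _ ht]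
        _ ≤ _ := by gcongr; linarith [one_div_pos.2 hFT]
    · have h1 : tail F T ≤ tail F (x / y) := tail_antitone ht
      calc _ ≤ (1 : ℝ) := measureReal_le_one
        _ = 1 / tail F T * tail F T := by field_simp
        _ ≤ 1 / tail F T * tail F (x / y) := by gcongr
        _ ≤ _ := by gcongr; linarith
  · filter_upwards [hprob, hpos, hG0] with y hy hy0 hynn
    rcases hynn.eq_or_lt with rfl | hypos
    · rw [Real.zero_rpow hα.ne', mul_zero]
      refine tendsto_const_nhds.congr' ?_
      filter_upwards [eventually_gt_atTop 0] with x hx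
      have : A x 0 = ∅ := by
        ext p; simp [hAdef, hx.le]
      rw [this, measureReal_empty, zero_div]
    · have hdy : Tendsto (fun u => 1 + θ * φ₁ u * φ₂ y) atTop (𝓝 (1 + θ * d₁ * φ₂ y)) :=
        ((hd.const_mul θ).mul_const _).const_add 1
      have h1 := tendsto_tail_withDensity_div hRV.tail_pos (hfint y) hy0 hdy
      have h2 := hRV.tendsto_measureReal_lt_add h1 hν
      have h3 := (h2.comp (tendsto_id.atTop_mul_const (inv_pos.2 hypos))).mul
        (hRV.2 _ (inv_pos.2 hypos))
      rw [Real.inv_rpow hypos.le, Real.rpow_neg hypos.le, inv_inv] at h3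
      refine h3.congr fun x => ?_
      rw [hApos x y hypos, div_eq_mul_inv x y]
      exact div_mul_div_cancel₀ (hRV.tail_pos _).ne'

end Mixture

/-! ### Boundedness of the Sarmanov kernels -/

section Kernels

theorem exists_mem_pos_of_integral_eq_zero {β : Type*} [MeasurableSpace β] {μ : Measure β}
    {f : β → ℝ} (hf : Integrable f μ) (h0 : ∫ u, f u ∂μ = 0) (hne : ¬ f =ᵐ[μ] 0) {S : Set β}
    (hS : S ∈ ae μ) : ∃ u ∈ S, 0 < f u := by
  by_contra! h
  refine hne ?_
  have h1 : 0 ≤ᵐ[μ] fun u => -f u := by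
    filter_upwards [hS] with u hu
    exact neg_nonneg.2 (h u hu)
  have h2 := (integral_eq_zero_iff_of_nonneg_ae h1 hf.neg).1 (by
    change ∫ u, -f u ∂μ = 0
    rw [integral_neg, h0, neg_zero])
  filter_upwards [h2] with u hu
  exact neg_eq_zero.1 hu

/-- A centred nonzero function takes both signs on `S`: a point with `f u > 0` bounds `r` below, one
with `f v < 0` bounds it above. -/
theorem exists_bound_of_one_add_mul_nonneg {β : Type*} [MeasurableSpace β] {μ : Measure β}
    {f : β → ℝ} (hf : Integrable f μ) (h0 : ∫ u, f u ∂μ = 0) (hne : ¬ f =ᵐ[μ] 0) {S : Set β}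
    (hS : S ∈ ae μ) : ∃ B, 0 ≤ B ∧ ∀ r : ℝ, (∀ u ∈ S, 0 ≤ 1 + f u * r) → |r| ≤ B := by
  obtain ⟨u, hu, hfu⟩ := exists_mem_pos_of_integral_eq_zero hf h0 hne hS
  obtain ⟨v, hv, hfv⟩ := exists_mem_pos_of_integral_eq_zero (f := fun u => -f u) hf.neg
    (by rw [integral_neg, h0, neg_zero])
    (fun h => hne (by filter_upwards [h] with u hu; exact neg_eq_zero.1 hu)) hS
  refine ⟨1 / f u + 1 / (-f v), by positivity, fun r hr => ?_⟩
  have h1 := hr u hu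
  have h2 := hr v hv
  have h3 : -(1 / f u) ≤ r := by rw [neg_le, le_div_iff₀ hfu]; linarith
  have h4 : r ≤ 1 / (-f v) := by rw [le_div_iff₀ hfv]; linarith
  have h5 := one_div_pos.2 hfu
  have h6 := one_div_pos.2 hfv
  exact abs_le.2 ⟨by linarith, by linarith⟩

variable {F G : Measure ℝ} {θ : ℝ} {φ₁ φ₂ : ℝ → ℝ}

theorem ae_ae_of_forall_support {p : ℝ → ℝ → Prop}
    (h : ∀ x ∈ F.support, ∀ y ∈ G.support, p x y) : ∀ᵐ y ∂G, ∀ᵐ x ∂F, p x y := by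
  filter_upwards [Measure.support_mem_ae (μ := G)] with y hy
  filter_upwards [Measure.support_mem_ae (μ := F)] with x hx
  exact h x hx y hy

/-- The density of a Sarmanov law is essentially bounded. -/
theorem exists_density_le (h1 : Integrable φ₁ F) (h2 : Integrable φ₂ G)
    (hm1 : ∫ u, φ₁ u ∂F = 0) (hm2 : ∫ y, φ₂ y ∂G = 0)
    (hpos : ∀ x ∈ F.support, ∀ y ∈ G.support, 0 ≤ 1 + θ * φ₁ x * φ₂ y) :
    ∃ B, ∀ᵐ y ∂G, ∀ᵐ u ∂F, 1 + θ * φ₁ u * φ₂ y ≤ B := by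
  -- If either factor vanishes almost everywhere the density is one; otherwise each factor bounds
  -- the other.
  by_cases hF : (fun u => θ * φ₁ u) =ᵐ[F] 0
  · refine ⟨1, Eventually.of_forall fun y => ?_⟩
    filter_upwards [hF] with u hu
    simp only [Pi.zero_apply] at hu
    rw [hu, zero_mul, add_zero]
  by_cases hG : φ₂ =ᵐ[G] 0
  · refine ⟨1, ?_⟩
    filter_upwards [hG] with y hy
    refine Eventually.of_forall fun u => ?_
    rw [hy, Pi.zero_apply, mul_zero, add_zero]
  obtain ⟨B₁, hB₁, hb₁⟩ := exists_bound_of_one_add_mul_nonneg (h1.const_mul θ)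
    (by rw [integral_const_mul, hm1, mul_zero]) hF (Measure.support_mem_ae (μ := F))
  obtain ⟨B₂, hB₂, hb₂⟩ := exists_bound_of_one_add_mul_nonneg h2 hm2 hG
    (Measure.support_mem_ae (μ := G))
  refine ⟨1 + B₂ * B₁, ae_ae_of_forall_support fun x hx y hy => ?_⟩
  have h3 := hb₁ (φ₂ y) fun u hu => hpos u hu y hy
  have h4 := hb₂ (θ * φ₁ x) fun v hv => by rw [mul_comm]; exact hpos x hx v hv
  have h5 : |θ * φ₁ x * φ₂ y| ≤ B₂ * B₁ := by
    rw [abs_mul]; exact mul_le_mul h4 h3 (abs_nonneg _) hB₂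
  linarith [le_abs_self (θ * φ₁ x * φ₂ y)]

/-- If the first kernel does not vanish at infinity then the second one is essentially bounded. -/
theorem exists_kernel_bound (h1 : Integrable φ₁ F) (hm1 : ∫ u, φ₁ u ∂F = 0)
    (hpos : ∀ x ∈ F.support, ∀ y ∈ G.support, 0 ≤ 1 + θ * φ₁ x * φ₂ y)
    (hF : ∀ x, 0 < tail F x) {d₁ : ℝ} (hd : Tendsto φ₁ atTop (𝓝 d₁)) (hθ : θ * d₁ ≠ 0) :
    ∃ B, ∀ᵐ y ∂G, ‖φ₂ y‖ ≤ B := by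
  -- The limit `θ d₁` is nonzero and `F` charges every half-line, so the first factor cannot vanish
  -- almost everywhere.
  have hne : ¬ (fun u => θ * φ₁ u) =ᵐ[F] 0 := by
    intro h
    obtain ⟨T, hT⟩ := eventually_atTop.1 ((hd.const_mul θ).eventually_ne hθ)
    have hz : F (Set.Ioi T) = 0 := measure_mono_null (fun u hu => hT u (le_of_lt hu)) h
    have := hF T
    simp [tail, Measure.real, hz] at this
  obtain ⟨B, -, hB⟩ := exists_bound_of_one_add_mul_nonneg (h1.const_mul θ)
    (by rw [integral_const_mul, hm1, mul_zero]) hne (Measure.support_mem_ae (μ := F))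
  refine ⟨B, ?_⟩
  filter_upwards [Measure.support_mem_ae (μ := G)] with y hy
  exact hB _ fun u hu => hpos u hu y hy

end Kernels

/-! ### Backward recursion for the running maximum -/

section RunningMax

variable {Ω : Type*}

/-- The running maximum `max_{0 ≤ k ≤ n} S_k` of the aggregate losses, computed backwards. -/
def runningMax : ℕ → (ℕ → Ω → ℝ) → (ℕ → Ω → ℝ) → Ω → ℝ
  | 0, _, _ => fun _ => 0
  | n + 1, X, Y => fun ω =>
    max 0 (Y 0 ω * (X 0 ω + runningMax n (fun i => X (i + 1)) (fun i => Y (i + 1)) ω))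

theorem runningMax_nonneg (n : ℕ) (X Y : ℕ → Ω → ℝ) (ω : Ω) : 0 ≤ runningMax n X Y ω := by
  cases n with
  | zero => exact le_rfl
  | succ n => exact le_max_left _ _

/-- The σ-algebra is left free so that the independence proof can take the one generated by the
later vectors. -/
theorem measurable_runningMax {m : MeasurableSpace Ω} (n : ℕ) {X Y : ℕ → Ω → ℝ}
    (hX : ∀ i, Measurable (X i)) (hY : ∀ i, Measurable (Y i)) :
    Measurable (runningMax n X Y) := by
  induction n generalizing X Y with
  | zero => exact measurable_const
  | succ n ih =>
    exact measurable_const.max ((hY 0).mul ((hX 0).add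
      (ih (fun i => hX (i + 1)) fun i => hY (i + 1))))

theorem aggLoss_succ (X Y : ℕ → Ω → ℝ) (k : ℕ) (ω : Ω) :
    aggLoss X Y (k + 1) ω =
      Y 0 ω * (X 0 ω + aggLoss (fun i => X (i + 1)) (fun i => Y (i + 1)) k ω) := by
  simp only [aggLoss]
  rw [Finset.sum_range_succ', mul_add, Finset.mul_sum, add_comm]
  congr 1
  · simp [mul_comm]
  · refine Finset.sum_congr rfl fun i _ => ?_
    rw [Finset.prod_range_succ' _ (i + 1)]
    ring

theorem aggLoss_le_runningMax {n k : ℕ} (hk : k ≤ n) {X Y : ℕ → Ω → ℝ} {ω : Ω}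
    (hY : ∀ i, 0 ≤ Y i ω) : aggLoss X Y k ω ≤ runningMax n X Y ω := by
  induction n generalizing X Y k with
  | zero =>
    obtain rfl : k = 0 := by omega
    simp [aggLoss, runningMax]
  | succ n ih =>
    cases k with
    | zero => simpa [aggLoss] using runningMax_nonneg (n + 1) X Y ω
    | succ k =>
      rw [aggLoss_succ]
      refine le_trans ?_ (le_max_right _ _)
      have := ih (k := k) (by omega) (X := fun i => X (i + 1)) (Y := fun i => Y (i + 1))
        fun i => hY (i + 1)
      have := hY 0
      gcongr

theorem exists_runningMax_eq (n : ℕ) (X Y : ℕ → Ω → ℝ) (ω : Ω) :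
    ∃ k ≤ n, runningMax n X Y ω = aggLoss X Y k ω := by
  induction n generalizing X Y with
  | zero => exact ⟨0, le_rfl, by simp [aggLoss, runningMax]⟩
  | succ n ih =>
    obtain ⟨k, hk, h⟩ := ih (fun i => X (i + 1)) fun i => Y (i + 1)
    simp only [runningMax]
    rw [h, ← aggLoss_succ]
    rcases max_choice 0 (aggLoss X Y (k + 1) ω) with h' | h'
    · exact ⟨0, by omega, by rw [h']; simp [aggLoss]⟩
    · exact ⟨k + 1, by omega, h'⟩

/-- The running maximum also ranges over `k = 0`, where the loss is `0` and cannot exceed `x ≥ 0`.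
-/
theorem lt_sup'_aggLoss_iff {n : ℕ} (hn : 1 ≤ n) {X Y : ℕ → Ω → ℝ} {ω : Ω}
    (hY : ∀ i, 0 ≤ Y i ω) {x : ℝ} (hx : 0 ≤ x) :
    x < (Finset.Icc 1 n).sup' (Finset.nonempty_Icc.mpr hn) (fun k => aggLoss X Y k ω) ↔
      x < runningMax n X Y ω := by
  rw [Finset.lt_sup'_iff]
  constructor
  · rintro ⟨k, hk, h⟩
    exact h.trans_le (aggLoss_le_runningMax (Finset.mem_Icc.1 hk).2 hY)
  · intro h
    obtain ⟨k, hk, h'⟩ := exists_runningMax_eq n X Y ω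
    rw [h'] at h
    refine ⟨k, Finset.mem_Icc.2 ⟨?_, hk⟩, h⟩
    by_contra hk0
    obtain rfl : k = 0 := by omega
    simp [aggLoss] at h
    linarith

variable [MeasurableSpace Ω] {P : Measure Ω} {X Y : ℕ → Ω → ℝ}

theorem indepFun_runningMax_succ (hX : ∀ i, Measurable (X i)) (hY : ∀ i, Measurable (Y i))
    (hindep : iIndepFun (fun i ω => (X i ω, Y i ω)) P) (n : ℕ) :
    IndepFun (fun ω => (X 0 ω, Y 0 ω))
      (runningMax n (fun i => X (i + 1)) fun i => Y (i + 1)) P := by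
  set m : ℕ → MeasurableSpace Ω := fun i =>
    MeasurableSpace.comap (fun ω => (X i ω, Y i ω)) inferInstance with hm
  have hle : ∀ i, m i ≤ ‹MeasurableSpace Ω› := fun i => ((hX i).prodMk (hY i)).comap_le
  have h := indep_iSup_of_disjoint (m := m) (μ := P) hle hindep.iIndep
    (S := {0}) (T := {0}ᶜ) disjoint_compl_right
  refine indep_of_indep_of_le_left (indep_of_indep_of_le_right h ?_) ?_
  · have hZ : ∀ i, Measurable[⨆ j ∈ ({0}ᶜ : Set ℕ), m j] fun ω => (X (i + 1) ω, Y (i + 1) ω) :=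
      fun i => (comap_measurable _).mono
        (le_iSup₂ (f := fun j (_ : j ∈ ({0}ᶜ : Set ℕ)) => m j) (i + 1) (by simp)) le_rfl
    exact (measurable_runningMax (m := ⨆ j ∈ ({0}ᶜ : Set ℕ), m j) n
      (fun i => measurable_fst.comp (hZ i)) fun i => measurable_snd.comp (hZ i)).comap_le
  · exact le_iSup₂ (f := fun j (_ : j ∈ ({0} : Set ℕ)) => m j) 0 rfl

theorem tail_map_runningMax_succ [IsProbabilityMeasure P] (hX : ∀ i, Measurable (X i))
    (hY : ∀ i, Measurable (Y i)) (hindep : iIndepFun (fun i ω => (X i ω, Y i ω)) P) (n : ℕ)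
    {x : ℝ} (hx : 0 ≤ x) :
    tail (P.map (runningMax (n + 1) X Y)) x = ((P.map fun ω => (X 0 ω, Y 0 ω)).prod
      (P.map (runningMax n (fun i => X (i + 1)) fun i => Y (i + 1)))).real
        {q | x < q.1.2 * (q.1.1 + q.2)} := by
  have hW := measurable_runningMax n (fun i => hX (i + 1)) fun i => hY (i + 1)
  rw [← (indepFun_iff_map_prod_eq_prod_map_map ((hX 0).prodMk (hY 0)).aemeasurable
    hW.aemeasurable).1 (indepFun_runningMax_succ hX hY hindep n), tail,
    map_measureReal_apply (measurable_runningMax _ hX hY) measurableSet_Ioi,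
    map_measureReal_apply (((hX 0).prodMk (hY 0)).prodMk hW)
      (measurableSet_lt measurable_const (by fun_prop))]
  congr 1
  ext ω
  simp [runningMax, hx.not_gt]

end RunningMax

/-! ### The geometric factor -/

theorem geomFactor_zero (a : ℝ) : geomFactor a 0 = 0 := by simp [geomFactor]

theorem geomFactor_succ (a : ℝ) (n : ℕ) : geomFactor a (n + 1) = 1 + a * geomFactor a n := by
  unfold geomFactor
  split_ifs with h
  · subst h; push_cast; ring
  · have : 1 - a ≠ 0 := fun h' => h (by linarith)
    field_simp
    ring

theorem geomFactor_nonneg {a : ℝ} (ha : 0 ≤ a) (n : ℕ) : 0 ≤ geomFactor a n := by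
  induction n with
  | zero => rw [geomFactor_zero]
  | succ n ih => rw [geomFactor_succ]; positivity

theorem geomFactor_pos {a : ℝ} (ha : 0 ≤ a) {n : ℕ} (hn : 1 ≤ n) : 0 < geomFactor a n := by
  obtain ⟨k, rfl⟩ := Nat.exists_eq_add_of_le' hn
  rw [geomFactor_succ]
  have := geomFactor_nonneg ha k
  positivity

/-! ### Induction on the horizon -/

section Recursion

variable {Ω : Type*} [MeasurableSpace Ω] {P : Measure Ω} [IsProbabilityMeasure P]

theorem IsSarmanov.integrable_kernel_mul {X Y : Ω → ℝ} {θ d₁ α : ℝ} {φ₁ φ₂ : ℝ → ℝ}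
    (hs : IsSarmanov P X Y θ φ₁ φ₂) (hX : Measurable X) (hY : Measurable Y)
    (hRV : IsRegVarying α (P.map X)) (hmom : Integrable (fun ω => Y ω ^ α) P)
    (hd : Tendsto φ₁ atTop (𝓝 d₁)) (hθ : θ * d₁ ≠ 0) :
    Integrable (fun ω => φ₂ (Y ω) * Y ω ^ α) P := by
  have : IsProbabilityMeasure (P.map X) := Measure.isProbabilityMeasure_map hX.aemeasurable
  obtain ⟨B, hB⟩ := exists_kernel_bound
    ((integrable_map_measure hs.measurable_fst.aestronglyMeasurable hX.aemeasurable).2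
      hs.integrable_fst)
    (by rw [integral_map hX.aemeasurable hs.measurable_fst.aestronglyMeasurable]; exact hs.mean_fst)
    hs.density_nonneg hRV.tail_pos hd hθ
  exact hmom.bdd_mul (hs.measurable_snd.comp hY).aestronglyMeasurable
    (ae_of_ae_map hY.aemeasurable hB)

/-- The reference pair is separate from the sequence, so that the induction can shift the sequence
while keeping `F` and `G` fixed. -/
theorem IsSarmanov.tendsto_tail_runningMax {X₀ Y₀ : Ω → ℝ} {θ d₁ α : ℝ} {φ₁ φ₂ : ℝ → ℝ}
    (hs : IsSarmanov P X₀ Y₀ θ φ₁ φ₂) (hX₀ : Measurable X₀) (hY₀ : Measurable Y₀)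
    (hRV : IsRegVarying α (P.map X₀)) (hN : TailNegligible (P.map X₀) (P.map Y₀))
    (hmom : Integrable (fun ω => Y₀ ω ^ α) P) (hd : Tendsto φ₁ atTop (𝓝 d₁))
    (n : ℕ) {X Y : ℕ → Ω → ℝ} (hX : ∀ i, Measurable (X i)) (hY : ∀ i, Measurable (Y i))
    (hindep : iIndepFun (fun i ω => (X i ω, Y i ω)) P)
    (hlaw : ∀ i, P.map (fun ω => (X i ω, Y i ω)) = P.map fun ω => (X₀ ω, Y₀ ω)) :
    Tendsto (fun x => tail (P.map (runningMax n X Y)) x / tail (P.map X₀) x) atTop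
      (𝓝 (geomFactor (∫ ω, Y₀ ω ^ α ∂P) n * ruinConst P Y₀ α θ d₁ φ₂)) := by
  have hF : IsProbabilityMeasure (P.map X₀) := Measure.isProbabilityMeasure_map hX₀.aemeasurable
  have hG : IsProbabilityMeasure (P.map Y₀) := Measure.isProbabilityMeasure_map hY₀.aemeasurable
  have hα := hRV.1
  induction n generalizing X Y with
  | zero =>
    rw [geomFactor_zero, zero_mul]
    refine tendsto_const_nhds.congr' ?_
    filter_upwards [eventually_ge_atTop 0] with x hx
    have : tail (P.map (runningMax 0 X Y)) x = 0 := by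
      rw [tail, map_measureReal_apply (measurable_runningMax 0 hX hY) measurableSet_Ioi]
      have : runningMax 0 X Y ⁻¹' Set.Ioi x = ∅ := by
        ext ω; simp [runningMax, hx]
      rw [this, measureReal_empty]
    rw [this, zero_div]
  | succ n ih =>
    have hW := measurable_runningMax n (fun i => hX (i + 1)) fun i => hY (i + 1)
    have hν := ih (fun i => hX (i + 1)) (fun i => hY (i + 1))
      (hindep.precomp (add_left_injective 1)) fun i => hlaw (i + 1)
    have hνp := Measure.isProbabilityMeasure_map (μ := P) hW.aemeasurable
    set c := geomFactor (∫ ω, Y₀ ω ^ α ∂P) n * ruinConst P Y₀ α θ d₁ φ₂ with hc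
    have hpow : Measurable fun y : ℝ => y ^ α := by fun_prop
    have hφ₂ := hs.measurable_snd
    have hlm : Measurable fun y => (1 + θ * d₁ * φ₂ y + c) * y ^ α := by fun_prop
    -- When `θ * d₁ = 0` the kernel moment may be infinite, but the product is identically zero.
    have hkint : Integrable (fun ω => θ * d₁ * (φ₂ (Y₀ ω) * Y₀ ω ^ α)) P := by
      by_cases hθ : θ * d₁ = 0
      · simp [hθ]
      · exact (hs.integrable_kernel_mul hX₀ hY₀ hRV hmom hd hθ).const_mul _
    have hsplit : (fun ω => (1 + θ * d₁ * φ₂ (Y₀ ω) + c) * Y₀ ω ^ α) =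
        fun ω => (1 + c) * Y₀ ω ^ α + θ * d₁ * (φ₂ (Y₀ ω) * Y₀ ω ^ α) := by
      ext ω; ring
    have hl : Integrable (fun y => (1 + θ * d₁ * φ₂ y + c) * y ^ α) (P.map Y₀) := by
      rw [integrable_map_measure hlm.aestronglyMeasurable hY₀.aemeasurable]
      change Integrable (fun ω => (1 + θ * d₁ * φ₂ (Y₀ ω) + c) * Y₀ ω ^ α) P
      rw [hsplit]
      exact (hmom.const_mul (1 + c)).add hkint
    have hI : ∫ y, (1 + θ * d₁ * φ₂ y + c) * y ^ α ∂(P.map Y₀) =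
        geomFactor (∫ ω, Y₀ ω ^ α ∂P) (n + 1) * ruinConst P Y₀ α θ d₁ φ₂ := by
      rw [integral_map hY₀.aemeasurable hlm.aestronglyMeasurable, hsplit,
        integral_add (hmom.const_mul _) hkint, integral_const_mul, integral_const_mul,
        geomFactor_succ, hc]
      simp only [ruinConst]
      ring
    have hint₁ := (integrable_map_measure (μ := P) hs.measurable_fst.aestronglyMeasurable
      hX₀.aemeasurable).2 hs.integrable_fst
    have hint₂ := (integrable_map_measure (μ := P) hs.measurable_snd.aestronglyMeasurable
      hY₀.aemeasurable).2 hs.integrable_snd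
    have hm₁ : ∫ u, φ₁ u ∂(P.map X₀) = 0 := by
      rw [integral_map hX₀.aemeasurable hs.measurable_fst.aestronglyMeasurable, hs.mean_fst]
    have hm₂ : ∫ y, φ₂ y ∂(P.map Y₀) = 0 := by
      rw [integral_map hY₀.aemeasurable hs.measurable_snd.aestronglyMeasurable, hs.mean_snd]
    obtain ⟨B, hB⟩ := exists_density_le hint₁ hint₂ hm₁ hm₂ hs.density_nonneg
    have hstep := tendsto_tail_mul_add_div hRV hN
      ((ae_map_iff hY₀.aemeasurable measurableSet_Ici).2 hs.nonneg) hs.measurable_fst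
      hs.measurable_snd hint₁ hm₁ (ae_ae_of_forall_support hs.density_nonneg) hB hd hν hl
    rw [hI] at hstep
    refine hstep.congr' ?_
    filter_upwards [eventually_ge_atTop 0] with x hx
    rw [tail_map_runningMax_succ hX hY hindep n hx, hlaw 0, hs.law_eq]
    rfl

end Recursion

end Ruin

/-- Asymptotics of the finite time ruin probability. The expectation of `φ₂(Y) Y ^ α` is finite
whenever its coefficient is non-zero; the ratio of the ruin probability to the tail of `X`
converges to the stated constant, and, when that constant does not degenerate to `0`, this is
the asymptotic equivalence of the two sides. -/
theorem theorem5 {Ω : Type*} [MeasurableSpace Ω] (P : Measure Ω) [IsProbabilityMeasure P]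
    (X Y : ℕ → Ω → ℝ)
    (hX : ∀ i, Measurable (X i)) (hY : ∀ i, Measurable (Y i))
    (hindep : iIndepFun (fun i ω => (X i ω, Y i ω)) P)
    (hident : ∀ i, IdentDistrib (fun ω => (X i ω, Y i ω)) (fun ω => (X 0 ω, Y 0 ω)) P P)
    (θ : ℝ) (φ₁ φ₂ : ℝ → ℝ)
    (hsarm : Ruin.IsSarmanov P (X 0) (Y 0) θ φ₁ φ₂)
    (α : ℝ) (hRV : Ruin.IsRegVarying α (P.map (X 0)))
    (hmom : Integrable (fun ω => Y 0 ω ^ α) P)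
    (htail : Ruin.tail (P.map (Y 0)) =o[atTop] Ruin.tail (P.map (X 0)))
    (d₁ : ℝ) (hd : Tendsto φ₁ atTop (𝓝 d₁))
    (hDZ : Ruin.DZ2 α (P.map (X 0)) ∨ Ruin.DZ3 α (P.map (X 0)) (P.map (Y 0)) ∨
      Ruin.DZ4 α (P.map (X 0)) (P.map (Y 0)))
    (n : ℕ) (hn : 1 ≤ n) :
    (θ * d₁ ≠ 0 → Integrable (fun ω => φ₂ (Y 0 ω) * Y 0 ω ^ α) P) ∧
    Tendsto (fun x => Ruin.ruinProb P X Y n hn x / Ruin.tail (P.map (X 0)) x) atTop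
      (𝓝 (Ruin.geomFactor (∫ ω, Y 0 ω ^ α ∂P) n * Ruin.ruinConst P (Y 0) α θ d₁ φ₂)) ∧
    (Ruin.ruinConst P (Y 0) α θ d₁ φ₂ ≠ 0 →
      Ruin.ruinProb P X Y n hn ~[atTop]
        (fun x => Ruin.geomFactor (∫ ω, Y 0 ω ^ α ∂P) n * Ruin.ruinConst P (Y 0) α θ d₁ φ₂ *
          Ruin.tail (P.map (X 0)) x)) := by
  have hX₀ := hX 0
  have hY₀ := hY 0
  have hF : IsProbabilityMeasure (P.map (X 0)) := Measure.isProbabilityMeasure_map hX₀.aemeasurable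
  have hG : IsProbabilityMeasure (P.map (Y 0)) := Measure.isProbabilityMeasure_map hY₀.aemeasurable
  have hpow : Measurable fun y : ℝ => y ^ α := by fun_prop
  have hN : Ruin.TailNegligible (P.map (X 0)) (P.map (Y 0)) := by
    rcases hDZ with h | h | h
    · exact h.tailNegligible hRV htail
    · exact h.tailNegligible hRV htail
    · exact h.tailNegligible hRV htail
        ((integrable_map_measure hpow.aestronglyMeasurable hY₀.aemeasurable).2 hmom)
  have hYnn : ∀ᵐ ω ∂P, ∀ i, 0 ≤ Y i ω := by
    refine ae_all_iff.2 fun i => ?_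
    have hi : P.map (Y i) = P.map (Y 0) := ((hident i).comp measurable_snd).map_eq
    have h0 := (ae_map_iff hY₀.aemeasurable measurableSet_Ici).2 hsarm.nonneg
    rw [← hi] at h0
    exact (ae_map_iff (hY i).aemeasurable measurableSet_Ici).1 h0
  have hlim : Tendsto (fun x => Ruin.ruinProb P X Y n hn x / Ruin.tail (P.map (X 0)) x) atTop
      (𝓝 (Ruin.geomFactor (∫ ω, Y 0 ω ^ α ∂P) n * Ruin.ruinConst P (Y 0) α θ d₁ φ₂)) := by
    refine (hsarm.tendsto_tail_runningMax hX₀ hY₀ hRV hN hmom hd n hX hY hindep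
      fun i => (hident i).map_eq).congr' ?_
    filter_upwards [eventually_ge_atTop 0] with x hx
    congr 1
    rw [Ruin.tail, map_measureReal_apply (Ruin.measurable_runningMax n hX hY) measurableSet_Ioi,
      Ruin.ruinProb]
    -- The two events agree only almost surely, since `Y` is nonnegative only almost surely.
    refine measureReal_congr ?_
    filter_upwards [hYnn] with ω hω
    exact propext (Ruin.lt_sup'_aggLoss_iff hn hω hx).symm
  refine ⟨fun hθ => hsarm.integrable_kernel_mul hX₀ hY₀ hRV hmom hd hθ, hlim, fun hC => ?_⟩
  have ha : 0 ≤ ∫ ω, Y 0 ω ^ α ∂P := integral_nonneg_of_ae <| by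
    filter_upwards [hYnn] with ω hω
    exact Real.rpow_nonneg (hω 0) _
  have hne := mul_ne_zero (Ruin.geomFactor_pos ha hn).ne' hC
  refine isEquivalent_of_tendsto_one ?_
  have h := hlim.div_const
    (Ruin.geomFactor (∫ ω, Y 0 ω ^ α ∂P) n * Ruin.ruinConst P (Y 0) α θ d₁ φ₂)
  rw [div_self hne] at h
  refine h.congr fun x => ?_
  rw [Pi.div_apply, div_div, mul_comm (Ruin.tail _ x)]
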